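/- Let $m,n$ be coprime positive integers. Write $(a_1,\dots,a_n\,|\,b_1,\dots,b_m)\in\mathbb Z^{n|m}$ for $\sum_i a_i\epsilon_i-\sum_j b_j\delta_j$, with the bilinear form $(\epsilon_i,\epsilon_j)=\delta_{ij}=-(\delta_i,\delta_j)$, $(\epsilon_i,\delta_j)=0$. For an integer $c$ let $\mathbf c=(c,\dots,c\,|\,c,\dots,c)$. **Groupoids.** The symmetric groupoid $\mathcal S(V)$ of a set $V$ has as objects the subsets of $V$ and as morphisms the bijections between subsets. An action of a groupoid $\mathcal G$ on $V$ is a functor $F:\mathcal G\to\mathcal S(V)$. Its Cayley graph is the directed graph on $V$ with an edge $v\to F(s)v$ whenever $F(s)v$ is defined. Its orbits are the connected components of the Cayley graph, and $F$ is transitive if there is exactly one orbit. An equivariant bijection between two transitive actions $F$ on $U$ and $B$ on $V$ is a bijection $\omega:U\to V$ with $\omega(F(a))=B(a)$ for every object $a$ and $\omega(F(s)u)=B(s)\omega(u)$ for every morphism $s$ and every $u$ for which $F(s)u$ is defined. Let $\mathfrak T_{iso}$ be the groupoid whose objects are the isotropic roots $\pm(\epsilon_i-\delta_j)$ ($1\le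 i\le n$, $1\le j\le m$) of $\mathfrak{gl}(n|m)$ and whose non-identity morphisms are $\rho_\alpha:\alpha\to-\alpha$, one for each $\alpha$. **Sergeev–Veselov action** (parameter $\kappa=-m/n$, in integral coordinates). For $\alpha=\epsilon_i-\delta_j$ put $v_\alpha=n\epsilon_i-m\delta_j$, $\Pi_\alpha=\{\Lambda:(\Lambda,\alpha)=0\}$, $\Pi_{-\alpha}=\{\Lambda:(\Lambda,\alpha)=n-m\}$. The functor $SV:\mathfrak T_{iso}\to\mathcal S(\mathbb Z^{n|m})$ is given by $SV(\pm\alpha)=\Pi_{\pm\alpha}$ and $SV(\rho_{\pm\alpha})(\Lambda)=\Lambda\pm v_\alpha$. Let $\mathbf O$ be the orbit of $\Lambda_0=(m(n-1),\dots,m,0\,|\,0,n,\dots,n(m-1))$, with the restricted action of $\mathfrak T_{iso}$. **Young diagrams.** Let $X$ be the set of partitions $\lambda=(\lambda_1\ge\dots\ge\lambda_n\ge0)$ with $\lambda_1\le m$, viewed as Young diagrams in the bottom left corner of a rectangle with rows $\epsilon_1,\dots,\epsilon_n$ from top to bottom and columns $\delta_1,\dots,\delta_m$ from left to right, row $\epsilon_i$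 containing $\lambda_{n+1-i}$ boxes. Let $\lambda'_j=|\{i:\lambda_i\ge j\}|$. For $\alpha=\epsilon_i-\delta_j$, let $t_\alpha(\lambda)$ (resp. $t_{-\alpha}(\lambda)$) be the diagram obtained from $\lambda$ by adding (resp. removing) the box in row $\epsilon_i$ and column $\delta_j$, defined whenever this box is not in $\lambda$ (resp. is in $\lambda$) and the result is a Young diagram. Let $\sim$ be the smallest equivalence relation on $X\times\mathbb Z$ such that $$(\lambda,k)\sim\big((\lambda_2,\dots,\lambda_n,0),k+m\big)\text{ if }\lambda_1=m,\qquad (\lambda,k)\sim\big((\lambda_1-1,\dots,\lambda_n-1),k+n\big)\text{ if }\lambda'_1=n,$$ let $[\lambda,k]$ be the class of $(\lambda,k)$ and $[X\times\mathbb Z]$ the set of classes. Let $\nu(a|b)=(a_n,a_1,\dots,a_{n-1}|b)$ and $\eta(a|b)=(a|b_2,\dots,b_m,b_1)$; correspondingly, on roots, $\nu\epsilon_i=\epsilon_{i+1}$ and $\eta\delta_{j+1}=\delta_j$, with indices mod $n$ and mod $m$ respectively, and $\nu$ fixes every $\delta_j$ and $\eta$ every $\epsilon_i$. **Theorem.**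 1. There is a unique functor $\mathcal F:\mathfrak T_{iso}\to\mathcal S([X\times\mathbb Z])$ such that, for every isotropic root $\alpha$, $\mathcal F(\alpha)$ is the set of all classes $[\lambda,in+jm]$ with $i,j\in\mathbb Z$ for which $t_{\eta^i\nu^j\alpha}(\lambda)$ is defined, and $\mathcal F(\rho_\alpha)[\lambda,in+jm]=[t_{\eta^i\nu^j\alpha}(\lambda),in+jm]$ for all such $\lambda,i,j$. 2. There is a unique map $\hat x:[X\times\mathbb Z]\to\mathbb Z^{n|m}$ such that $\hat x[\lambda,in+jm]=\eta^{-i}\nu^{-j}x(\lambda)+i\mathbf n+j\mathbf m$ for all $\lambda\in X$ and $i,j\in\mathbb Z$, where $x(\lambda)=(a|b)$ with $a_i=m(n-i)+n\lambda_{n+1-i}$ and $b_j=n(j-1)+m\lambda'_j$. 3. The map $\hat x$ is a $\mathfrak T_{iso}$-equivariant bijection from $[X\times\mathbb Z]$ onto $\mathbf O$; in particular $\mathcal F$ is transitive. Moreover $\hat x[\emptyset,0]=\Lambda_0$. 4. Consequently, $\hat x$ is an isomorphism from the Cayley graph of $\mathcal F$ onto the Cayley graph of $\mathbf O$. -/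

import Mathlib

open CategoryTheory

/-! Symmetric groupoids, groupoid actions, Cayley graphs and orbits. -/

/-- The objects of the symmetric groupoid on `V`: the subsets of `V`. -/
@[ext] structure SymGpd (V : Type*) where
  carrier : Set V

/-- The morphisms of the symmetric groupoid are all bijections between subsets. -/
instance SymGpd.instGroupoid (V : Type*) : Groupoid (SymGpd V) where
  Hom A B := A.carrier ≃ B.carrier
  id A := Equiv.refl A.carrier
  comp f g := Equiv.trans f g
  inv f := Equiv.symm f
  id_comp _ := Equiv.ext fun _ => rfl
  comp_id _ := Equiv.ext fun _ => rfl
  assoc _ _ _ := Equiv.ext fun _ => rfl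
  inv_comp f := Equiv.ext fun x => Equiv.apply_symm_apply f x
  comp_inv f := Equiv.ext fun x => Equiv.symm_apply_apply f x

/-- The bijection between subsets underlying a morphism of the symmetric groupoid. -/
def SymGpd.toEquiv {V : Type*} {A B : SymGpd V} (f : A ⟶ B) : A.carrier ≃ B.carrier := f

section Actions

variable {G : Type*} [Groupoid G] {V : Type*}

/-- The Cayley graph of an action `F`: an edge `x ⟶ F(s) x` for every morphism `s`
such that `F(s) x` is defined. -/
def cayleyGraph (F : G ⥤ SymGpd V) : Digraph V where
  Adj x y := ∃ (a b : G) (s : a ⟶ b) (hx : x ∈ (F.obj a).carrier),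
    (SymGpd.toEquiv (F.map s) ⟨x, hx⟩ : V) = y

/-- The orbit of `x`: the vertices of the connected component of `x` in the Cayley graph. -/
def actionOrbit (F : G ⥤ SymGpd V) (x : V) : Set V :=
  {y | Relation.EqvGen (cayleyGraph F).Adj x y}

/-- The action is transitive: the whole set is a single orbit. -/
def IsTransitiveAction (F : G ⥤ SymGpd V) : Prop :=
  ∃ x, actionOrbit F x = Set.univ

theorem mem_actionOrbit_iff (F : G ⥤ SymGpd V) (x : V) {a b : G} (s : a ⟶ b)
    (y : (F.obj a).carrier) :
    (SymGpd.toEquiv (F.map s) y : V) ∈ actionOrbit F x ↔ (y : V) ∈ actionOrbit F x := by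
  have h : Relation.EqvGen (cayleyGraph F).Adj (y : V) (SymGpd.toEquiv (F.map s) y : V) :=
    Relation.EqvGen.rel _ _ ⟨a, b, s, y.2, rfl⟩
  exact ⟨fun hy => hy.trans _ _ _ (h.symm _ _), fun hy => hy.trans _ _ _ h⟩

theorem SymGpd.toEquiv_map_inv (F : G ⥤ SymGpd V) {a b : G} (s : a ⟶ b)
    (y : (F.obj b).carrier) :
    SymGpd.toEquiv (F.map s) (SymGpd.toEquiv (F.map (Groupoid.inv s)) y) = y := by
  have h : F.map (Groupoid.inv s) ≫ F.map s = 𝟙 _ := by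
    rw [← F.map_comp, Groupoid.inv_comp, F.map_id]
  exact congrArg (fun g => SymGpd.toEquiv g y) h

theorem SymGpd.toEquiv_inv_map (F : G ⥤ SymGpd V) {a b : G} (s : a ⟶ b)
    (y : (F.obj a).carrier) :
    SymGpd.toEquiv (F.map (Groupoid.inv s)) (SymGpd.toEquiv (F.map s) y) = y := by
  have h : F.map s ≫ F.map (Groupoid.inv s) = 𝟙 _ := by
    rw [← F.map_comp, Groupoid.comp_inv, F.map_id]
  exact congrArg (fun g => SymGpd.toEquiv g y) h

/-- The action of the groupoid on a single orbit, obtained by restriction. -/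
def restrictToOrbit (F : G ⥤ SymGpd V) (x : V) : G ⥤ SymGpd (actionOrbit F x) where
  obj a := ⟨{y | (y : V) ∈ (F.obj a).carrier}⟩
  map {a b} s :=
    { toFun := fun y => ⟨⟨(SymGpd.toEquiv (F.map s) ⟨y.1.1, y.2⟩ : V),
        (mem_actionOrbit_iff F x s ⟨y.1.1, y.2⟩).2 y.1.2⟩,
        (SymGpd.toEquiv (F.map s) ⟨y.1.1, y.2⟩).2⟩
      invFun := fun y => ⟨⟨(SymGpd.toEquiv (F.map (Groupoid.inv s)) ⟨y.1.1, y.2⟩ : V),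
        (mem_actionOrbit_iff F x (Groupoid.inv s) ⟨y.1.1, y.2⟩).2 y.1.2⟩,
        (SymGpd.toEquiv (F.map (Groupoid.inv s)) ⟨y.1.1, y.2⟩).2⟩
      left_inv := fun y => Subtype.ext <| Subtype.ext <| by
        have h := congrArg Subtype.val (SymGpd.toEquiv_inv_map F s ⟨y.1.1, y.2⟩)
        exact h
      right_inv := fun y => Subtype.ext <| Subtype.ext <| by
        have h := congrArg Subtype.val (SymGpd.toEquiv_map_inv F s ⟨y.1.1, y.2⟩)
        exact h }
  map_id a := Equiv.ext fun y => Subtype.ext <| Subtype.ext <|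
    congrArg (fun g => (SymGpd.toEquiv g ⟨y.1.1, y.2⟩ : V)) (F.map_id a)
  map_comp s t := Equiv.ext fun y => Subtype.ext <| Subtype.ext <|
    congrArg (fun g => (SymGpd.toEquiv g ⟨y.1.1, y.2⟩ : V)) (F.map_comp s t)

/-- `ω` is an equivariant bijection between the sets of two transitive actions `F`, `B` of the
same groupoid: transport along `ω` carries the functor `F` to the functor `B`, on objects
(`mem_iff`) and on morphisms (`map_eq`). -/
structure IsEquivariantBijection {U : Type*} (F : G ⥤ SymGpd U) (B : G ⥤ SymGpd V)
    (ω : U → V) : Prop where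
  bijective : Function.Bijective ω
  transitive_source : IsTransitiveAction F
  transitive_target : IsTransitiveAction B
  mem_iff : ∀ (a : G) (x : U), x ∈ (F.obj a).carrier ↔ ω x ∈ (B.obj a).carrier
  map_eq : ∀ {a b : G} (s : a ⟶ b) (x : U) (hx : x ∈ (F.obj a).carrier)
    (hy : ω x ∈ (B.obj a).carrier),
    ω (SymGpd.toEquiv (F.map s) ⟨x, hx⟩) = SymGpd.toEquiv (B.map s) ⟨ω x, hy⟩

end Actions

/-! The isotropic roots of `gl(n|m)` and the groupoid they define. -/

/-- The isotropic roots of `gl(n|m)`: `ε_i - δ_j` if `pos` is true, and `-(ε_i - δ_j)`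
otherwise. The indices of the `ε` and `δ` are counted from `0`. -/
@[ext] structure IsoRoot (n m : ℕ) where
  pos : Bool
  i : Fin n
  j : Fin m

instance (n m : ℕ) : Neg (IsoRoot n m) where
  neg α := ⟨!α.pos, α.i, α.j⟩

theorem IsoRoot.neg_neg {n m : ℕ} (α : IsoRoot n m) : - -α = α := by
  cases α with | mk p i j => cases p <;> rfl

theorem IsoRoot.neg_ne {n m : ℕ} (α : IsoRoot n m) : -α ≠ α := by
  cases α with | mk p i j => cases p <;> exact fun h => Bool.noConfusion (congrArg IsoRoot.pos h)

/-- The groupoid `𝔗_iso` with base the isotropic roots: for each `α` there are the identity of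
`α` and one morphism `α ⟶ -α`, and no others. -/
instance IsoRoot.instGroupoid (n m : ℕ) : Groupoid (IsoRoot n m) where
  Hom α β := PLift (β = α ∨ β = -α)
  id _ := ⟨Or.inl rfl⟩
  comp := by
    rintro α β γ ⟨h⟩ ⟨h'⟩
    refine ⟨?_⟩
    rcases h with rfl | rfl <;> rcases h' with rfl | rfl
    · exact Or.inl rfl
    · exact Or.inr rfl
    · exact Or.inr rfl
    · exact Or.inl α.neg_neg
  inv := by
    rintro α β ⟨h⟩
    refine ⟨?_⟩
    rcases h with rfl | rfl
    · exact Or.inl rfl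
    · exact Or.inr α.neg_neg.symm
  id_comp _ := rfl
  comp_id _ := rfl
  assoc _ _ _ := rfl
  inv_comp _ := rfl
  comp_inv _ := rfl

/-- The non-identity morphism `ρ_α : α ⟶ -α`. -/
def rho {n m : ℕ} (α : IsoRoot n m) : α ⟶ -α := PLift.up (Or.inr rfl)

/-- The rotation `ν` of the isotropic roots: `ε_i ↦ ε_{i+1}`, with index mod `n`. -/
def nuRoot (n m : ℕ) : Equiv.Perm (IsoRoot n m) where
  toFun α := ⟨α.pos, finRotate n α.i, α.j⟩
  invFun α := ⟨α.pos, (finRotate n).symm α.i, α.j⟩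
  left_inv α := IsoRoot.ext rfl ((finRotate n).symm_apply_apply α.i) rfl
  right_inv α := IsoRoot.ext rfl ((finRotate n).apply_symm_apply α.i) rfl

/-- The rotation `η` of the isotropic roots: `δ_{j+1} ↦ δ_j`, with index mod `m`. -/
def etaRoot (n m : ℕ) : Equiv.Perm (IsoRoot n m) where
  toFun α := ⟨α.pos, α.i, (finRotate m).symm α.j⟩
  invFun α := ⟨α.pos, α.i, finRotate m α.j⟩
  left_inv α := IsoRoot.ext rfl rfl ((finRotate m).apply_symm_apply α.j)
  right_inv α := IsoRoot.ext rfl rfl ((finRotate m).symm_apply_apply α.j)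

/-! The lattice `ℤ^{n|m}` and the Sergeev-Veselov action. -/

/-- `ℤ^{n|m}`; the pair `(a, b)` stands for
`(a_1, …, a_n | b_1, …, b_m) = ∑ a_i ε_i - ∑ b_j δ_j`. -/
abbrev Wt (n m : ℕ) : Type := (Fin n → ℤ) × (Fin m → ℤ)

namespace Wt

variable {n m : ℕ}

def eps (i : Fin n) : Wt n m := (Pi.single i 1, 0)

def del (j : Fin m) : Wt n m := (0, Pi.single j (-1))

/-- The bilinear form with `(ε_i, ε_j) = δ_{ij} = -(δ_i, δ_j)` and `(ε_i, δ_j) = 0`. -/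
def form (Λ M : Wt n m) : ℤ := ∑ i, Λ.1 i * M.1 i - ∑ j, Λ.2 j * M.2 j

/-- The vector `(c, …, c | c, …, c)`. -/
def const (c : ℤ) : Wt n m := (fun _ => c, fun _ => c)

/-- The operator `ν`: `(a_1, …, a_n | b) ↦ (a_n, a_1, …, a_{n-1} | b)`. -/
def nu (n m : ℕ) : Equiv.Perm (Wt n m) :=
  Equiv.prodCongr (Equiv.arrowCongr (finRotate n) (Equiv.refl ℤ)) (Equiv.refl _)

/-- The operator `η`: `(a | b_1, …, b_m) ↦ (a | b_2, …, b_m, b_1)`. -/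
def eta (n m : ℕ) : Equiv.Perm (Wt n m) :=
  Equiv.prodCongr (Equiv.refl _) (Equiv.arrowCongr (finRotate m).symm (Equiv.refl ℤ))

/-- `Λ₀ = (m(n-1), …, m, 0 | 0, n, …, n(m-1))`. -/
def base (n m : ℕ) : Wt n m :=
  (fun i => (m : ℤ) * ((n : ℤ) - 1 - (i : ℕ)), fun j => (n : ℤ) * (j : ℕ))

end Wt

section SergeevVeselov

variable {n m : ℕ}

/-- For positive `α`, `Π_α = {Λ | (Λ, α) = 0}` and `Π_{-α} = {Λ | (Λ, α) = n - m}`. -/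
def wall (α : IsoRoot n m) : Set (Wt n m) :=
  {Λ | Wt.form Λ (Wt.eps α.i - Wt.del α.j) = if α.pos then 0 else (n : ℤ) - (m : ℤ)}

/-- `v_α = n ε_i - m δ_j` for `α = ε_i - δ_j`, and `v_{-α} = -v_α`. -/
def shift (α : IsoRoot n m) : Wt n m :=
  (if α.pos then (1 : ℤ) else -1) • ((n : ℤ) • Wt.eps α.i - (m : ℤ) • Wt.del α.j)

theorem form_add_left (Λ M N : Wt n m) : Wt.form (Λ + M) N = Wt.form Λ N + Wt.form M N := by
  simp only [Wt.form, Prod.fst_add, Prod.snd_add, Pi.add_apply, add_mul, Finset.sum_add_distrib]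
  ring

theorem form_root (Λ : Wt n m) (i : Fin n) (j : Fin m) :
    Wt.form Λ (Wt.eps i - Wt.del j) = Λ.1 i - Λ.2 j := by
  simp [Wt.form, Wt.eps, Wt.del, Pi.single_apply]

theorem shift_neg (α : IsoRoot n m) : shift (-α) = -shift α := by
  change (if (!α.pos) = true then (1 : ℤ) else -1) • ((n : ℤ) • Wt.eps α.i - (m : ℤ) • Wt.del α.j)
    = _
  unfold shift
  cases α.pos <;> simp

theorem form_shift (α : IsoRoot n m) :
    Wt.form (shift α) (Wt.eps α.i - Wt.del α.j)
      = (if α.pos then (1 : ℤ) else -1) * ((n : ℤ) - (m : ℤ)) := by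
  rw [form_root]
  unfold shift
  cases α.pos
  · simp [Wt.eps, Wt.del]
    ring
  · simp [Wt.eps, Wt.del]

theorem add_shift_mem {α : IsoRoot n m} {Λ : Wt n m} (h : Λ ∈ wall α) :
    Λ + shift α ∈ wall (-α) := by
  have h1 : Wt.form Λ (Wt.eps α.i - Wt.del α.j) = if α.pos then 0 else (n : ℤ) - (m : ℤ) := h
  change Wt.form (Λ + shift α) (Wt.eps α.i - Wt.del α.j)
    = if (!α.pos) = true then 0 else (n : ℤ) - (m : ℤ)
  rw [form_add_left, form_shift, h1]
  cases α.pos <;> simp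

/-- The bijection `τ_α : Π_α → Π_{-α}`, `τ_α(Λ) = Λ + v_α` (and `τ_{-α}(Λ) = Λ - v_α`). -/
def tau (α : IsoRoot n m) : wall α ≃ wall (-α) where
  toFun Λ := ⟨Λ + shift α, add_shift_mem Λ.2⟩
  invFun Λ := ⟨Λ + shift (-α), by simpa only [α.neg_neg] using add_shift_mem Λ.2⟩
  left_inv Λ := Subtype.ext (by simp [shift_neg])
  right_inv Λ := Subtype.ext (by simp [shift_neg])

instance : DecidableEq (IsoRoot n m) := fun α β =>
  decidable_of_iff (α.pos = β.pos ∧ α.i = β.i ∧ α.j = β.j) IsoRoot.ext_iff.symm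

/-- The Sergeev-Veselov functor `SV : 𝔗_iso ⥤ 𝒮(ℤ^{n|m})`, with `SV(α) = Π_α` and
`SV(ρ_α) = τ_α`; identities go to identities. -/
def SV (n m : ℕ) : IsoRoot n m ⥤ SymGpd (Wt n m) where
  obj α := ⟨wall α⟩
  map {α β} s :=
    if h : β = α then Equiv.setCongr (congrArg wall h.symm)
    else (tau α).trans
      (Equiv.setCongr (congrArg wall (s.down.resolve_left h).symm))
  map_id α := by simp; rfl
  map_comp := by
    rintro α β γ ⟨h⟩ ⟨h'⟩
    rcases h with rfl | rfl <;> rcases h' with rfl | rfl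
    · simp; rfl
    · simp [IsoRoot.neg_ne]; rfl
    · simp [IsoRoot.neg_ne]; rfl
    · refine Equiv.ext fun Λ => Subtype.ext ?_
      simp only [IsoRoot.neg_neg, IsoRoot.neg_ne, dif_neg, not_false_eq_true]
      rw [dif_pos trivial, dif_neg (fun h => IsoRoot.neg_ne α h.symm)]
      change (Λ : Wt n m) = Λ + shift α + shift (-α)
      simp [shift_neg]

end SergeevVeselov

/-! Young diagrams in the `n × m` rectangle. -/

/-- A Young diagram in the rectangle with `n` rows and `m` columns, that is, a partition
`m ≥ λ_1 ≥ … ≥ λ_n ≥ 0`; the part `λ_{p+1}` is `parts p`. -/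
@[ext] structure Diagram (n m : ℕ) where
  parts : Fin n → ℕ
  anti : Antitone parts
  le : ∀ p, parts p ≤ m

namespace Diagram

variable {n m : ℕ}

/-- The set of boxes of `λ`: the diagram sits in the bottom left corner of the rectangle, whose
rows `ε_1, …, ε_n` are listed from the top, so row `ε_i` has `λ_{n+1-i}` boxes. -/
def boxes (l : Diagram n m) : Set (Fin n × Fin m) :=
  {c | (c.2 : ℕ) < l.parts c.1.rev}

/-- The dual partition: `λ'_j` is the number of parts that are at least `j`. -/
def conj (l : Diagram n m) (j : Fin m) : ℕ :=
  (Finset.univ.filter fun p => (j : ℕ) + 1 ≤ l.parts p).card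

/-- The empty diagram. -/
def empty (n m : ℕ) : Diagram n m := ⟨fun _ => 0, fun _ _ _ => le_rfl, fun _ => Nat.zero_le _⟩

/-- `μ = t_α(λ)`: for `α = ε_i - δ_j`, the box `(i, j)` is an outer corner of `λ` and adding it
gives `μ`; for `α = -(ε_i - δ_j)`, it is an inner corner of `λ` and removing it gives `μ`. -/
def Move (α : IsoRoot n m) (l μ : Diagram n m) : Prop :=
  if α.pos then (α.i, α.j) ∉ l.boxes ∧ μ.boxes = insert (α.i, α.j) l.boxes
  else (α.i, α.j) ∈ l.boxes ∧ μ.boxes = l.boxes \ {(α.i, α.j)}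

/-- Deletion of the lowest row (of length `λ_1`): `(λ_1, …, λ_n) ↦ (λ_2, …, λ_n, 0)`. -/
def delRow (l : Diagram n m) : Diagram n m where
  parts p := if h : (p : ℕ) + 1 < n then l.parts ⟨p + 1, h⟩ else 0
  anti p q hpq := by
    have hpq' : (p : ℕ) ≤ q := hpq
    beta_reduce
    split_ifs with h1 h2
    · exact l.anti (Fin.mk_le_mk.2 (by omega))
    · omega
    · exact Nat.zero_le _
    · exact le_rfl
  le p := by
    split_ifs
    · exact l.le _
    · exact Nat.zero_le _

/-- Deletion of the first column: every nonzero part decreases by `1`. -/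
def delCol (l : Diagram n m) : Diagram n m where
  parts p := l.parts p - 1
  anti _ _ hpq := Nat.sub_le_sub_right (l.anti hpq) 1
  le p := (Nat.sub_le _ _).trans (l.le p)

/-- The vector `x(λ)`, with `a_i = m(n-i) + n λ_{n+1-i}` and `b_j = n(j-1) + m λ'_j`. -/
def x (l : Diagram n m) : Wt n m :=
  Wt.base n m + (fun i => (n : ℤ) * (l.parts i.rev : ℤ), fun j => (m : ℤ) * (l.conj j : ℤ))

end Diagram

section Classes

variable {n m : ℕ} [NeZero n] [NeZero m]

/-- The generating relation on `X × ℤ`: a full row (`λ_1 = m`) or a full column (`λ'_1 = n`) is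
deleted. -/
inductive RotStep : Diagram n m × ℤ → Diagram n m × ℤ → Prop
  | row (l : Diagram n m) (k : ℤ) (h : l.parts 0 = m) : RotStep (l, k) (l.delRow, k + m)
  | col (l : Diagram n m) (k : ℤ) (h : l.conj 0 = n) : RotStep (l, k) (l.delCol, k + n)

variable (n m) in
/-- The set `[X × ℤ]` of classes of the smallest equivalence relation that contains the
generating relation. -/
def Cls : Type := Quotient (Relation.EqvGen.setoid (RotStep (n := n) (m := m)))

/-- The class `[λ, k]`. -/
def Cls.mk (l : Diagram n m) (k : ℤ) : Cls n m := Quotient.mk _ (l, k)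

/-- The set `𝒳_α` of classes `[λ, in + jm]` for which `t_β(λ)` is defined, `β = η^i ν^j α`. -/
def Cls.dom (α : IsoRoot n m) : Set (Cls n m) :=
  {s | ∃ (i j : ℤ) (l μ : Diagram n m),
    Diagram.Move ((etaRoot n m ^ i * nuRoot n m ^ j) α) l μ ∧ s = Cls.mk l (i * n + j * m)}

/-- `𝔽` is the Young diagram action: `𝔽(α) = 𝒳_α` for all `α`, and
`𝔽(ρ_α)[λ, in + jm] = [t_β(λ), in + jm]` for `β = η^i ν^j α`, whenever `t_β(λ)` is defined. -/
structure IsDiagramAction (𝔽 : IsoRoot n m ⥤ SymGpd (Cls n m)) : Prop where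
  obj_eq : ∀ α, (𝔽.obj α).carrier = Cls.dom α
  map_rho : ∀ (α : IsoRoot n m) (i j : ℤ) (l μ : Diagram n m),
    Diagram.Move ((etaRoot n m ^ i * nuRoot n m ^ j) α) l μ →
    ∀ h : Cls.mk l (i * n + j * m) ∈ (𝔽.obj α).carrier,
      (SymGpd.toEquiv (𝔽.map (rho α)) ⟨Cls.mk l (i * n + j * m), h⟩ : Cls n m)
        = Cls.mk μ (i * n + j * m)

/-- `f` is the map `x̂`: `x̂[λ, in + jm] = η^{-i} ν^{-j} x(λ) + (in + jm)(1, …, 1 | 1, …, 1)`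
for every diagram `λ` and all integers `i`, `j`. -/
def IsHatX (f : Cls n m → Wt n m) : Prop :=
  ∀ (l : Diagram n m) (i j : ℤ), f (Cls.mk l (i * n + j * m))
    = (Wt.eta n m ^ (-i) * Wt.nu n m ^ (-j)) l.x + Wt.const (i * n) + Wt.const (j * m)

end Classes

/-! Number rows from the bottom and columns from the left, both from `0`. Row `p` and column `q`
contribute to `x(λ)` the coordinates `mp + n·(length of row p)` and `nq + m·(height of column q)`.
At an outer corner `(p, q)` the row has length `q` and the column has height `p`, so both
coordinates equal `mp + nq`: thus `x(λ)` lies on the wall, and adding the box changes it by exactly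
`v_α` (`move_spec`). Deleting a full row or column turns `x` into its rotation by `ν` or `η` minus a
constant vector (`x_delRow`, `x_delCol`). Since `m` and `n` are coprime, every `k` is some `in +
jm`, with `(i, j)` unique up to multiples of `(m, -n)`; as `η^m = ν^n = 1`, the map `x̂` is well
defined.

The converse to the corner computation is `exists_move_of_mem_wall`: the wall equation reads `m·A =
n·B`, so `n` divides `A`, and the size of the rectangle leaves only a corner of `λ`, or a box that
becomes a corner after one full row is added or deleted. Hence the domain of `𝔽(ρ_α)` is the
preimage under `x̂` of the wall (`mem_dom_iff`).

Injectivity compares representatives whose level is a multiple of `n + m`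
(`hatX_normal_form_injective`). The image is the orbit of `Λ₀`: it is closed under the
Sergeev-Veselov moves by `mem_dom_iff`, and box removals together with full rows and columns connect
every class to `[∅, 0]`. The action `𝔽` is then the restricted Sergeev-Veselov action transported
along `x̂`, so functoriality, transitivity and the graph isomorphism come with the transport. -/

/-! ### Corners of diagrams and the effect of a move on `x(λ)`. -/

namespace Diagram

variable {n m : ℕ}

/-- Parts are antitone, so the rows that reach column `j` form an initial segment, and its
cardinality decides membership. -/
theorem lt_conj_iff (l : Diagram n m) (p : Fin n) (j : Fin m) :
    (p : ℕ) < l.conj j ↔ (j : ℕ) < l.parts p := by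
  unfold conj
  constructor
  · intro h
    by_contra hc
    have hsub : (Finset.univ.filter fun q => (j : ℕ) + 1 ≤ l.parts q) ⊆ Finset.Iio p := by
      intro q hq
      have hq' := (Finset.mem_filter.1 hq).2
      rw [Finset.mem_Iio]
      by_contra hqp
      have := l.anti (not_lt.1 hqp)
      omega
    have := Finset.card_le_card hsub
    rw [Fin.card_Iio] at this
    omega
  · intro h
    have hsub : Finset.Iic p ⊆ Finset.univ.filter fun q => (j : ℕ) + 1 ≤ l.parts q := by
      intro q hq
      have := l.anti (Finset.mem_Iic.1 hq)
      exact Finset.mem_filter.2 ⟨Finset.mem_univ _, by omega⟩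
    have := Finset.card_le_card hsub
    rw [Fin.card_Iic] at this
    omega

theorem conj_le (l : Diagram n m) (j : Fin m) : l.conj j ≤ n :=
  (Finset.card_filter_le _ _).trans (by simp)

/-- Computes column heights without counting. The bound `c ≤ n` is needed since `p < n` cannot
distinguish values above `n`. -/
theorem conj_eq_of_forall (l : Diagram n m) (j : Fin m) {c : ℕ} (hc : c ≤ n)
    (h : ∀ p : Fin n, (p : ℕ) < c ↔ (j : ℕ) < l.parts p) : l.conj j = c := by
  have hle := l.conj_le j
  rcases lt_trichotomy (l.conj j) c with hlt | heq | hgt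
  · have h1 := l.lt_conj_iff ⟨l.conj j, by omega⟩ j
    have h2 := h ⟨l.conj j, by omega⟩
    simp only at h1 h2
    omega
  · exact heq
  · have h1 := l.lt_conj_iff ⟨c, by omega⟩ j
    have h2 := h ⟨c, by omega⟩
    simp only at h1 h2
    omega

theorem x_fst (l : Diagram n m) (i : Fin n) :
    l.x.1 i = (m : ℤ) * (i.rev : ℕ) + n * l.parts i.rev := by
  have : ((i.rev : ℕ) : ℤ) = (n : ℤ) - 1 - (i : ℕ) := by
    rw [Fin.val_rev]; have := i.2; omega
  rw [this]; rfl

theorem x_snd (l : Diagram n m) (j : Fin m) :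
    l.x.2 j = (n : ℤ) * (j : ℕ) + m * l.conj j := rfl

theorem x_injective [NeZero n] : Function.Injective (x : Diagram n m → Wt n m) := by
  intro l l' h
  have hn : (n : ℤ) ≠ 0 := by exact_mod_cast NeZero.ne n
  refine Diagram.ext (funext fun p => ?_)
  have h1 := congrArg (fun Λ : Wt n m => Λ.1 p.rev) h
  simp only [x_fst, Fin.rev_rev] at h1
  exact_mod_cast mul_left_cancel₀ hn (add_left_cancel h1)

theorem mem_boxes (l : Diagram n m) (i : Fin n) (j : Fin m) :
    (i, j) ∈ l.boxes ↔ (j : ℕ) < l.parts i.rev := Iff.rfl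

/-- `λ ↦ t_α(λ)` for `α = ε_i - δ_j` in terms of membership of boxes. -/
theorem move_true_iff (i : Fin n) (j : Fin m) (l μ : Diagram n m) :
    Move ⟨true, i, j⟩ l μ ↔ l.parts i.rev ≤ j ∧
      ∀ (p : Fin n) (q : Fin m),
        (q : ℕ) < μ.parts p ↔ (p = i.rev ∧ q = j) ∨ (q : ℕ) < l.parts p := by
  simp only [Move, if_true, mem_boxes, not_lt]
  refine and_congr_right fun _ => ?_
  rw [Set.ext_iff]
  constructor
  · intro h p q
    have := h (p.rev, q)
    simpa [mem_boxes, Fin.rev_eq_iff] using this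
  · rintro h ⟨a, b⟩
    have := h a.rev b
    simpa [mem_boxes] using this

/-- Reduces facts about removing boxes to facts about adding them. -/
theorem move_false_iff (i : Fin n) (j : Fin m) (l μ : Diagram n m) :
    Move ⟨false, i, j⟩ l μ ↔ Move ⟨true, i, j⟩ μ l := by
  simp only [Move, if_true, Bool.false_eq_true, if_false]
  constructor
  · rintro ⟨h1, h2⟩
    rw [h2]
    exact ⟨by simp, by simp [Set.insert_eq_of_mem h1]⟩
  · rintro ⟨h1, h2⟩
    rw [h2]
    exact ⟨by simp, by simp [h1]⟩

theorem exists_move_add (l : Diagram n m) (p : Fin n) (j : Fin m) (hp : l.parts p = j)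
    (h : ∀ q < p, (j : ℕ) < l.parts q) : ∃ μ, Move ⟨true, p.rev, j⟩ l μ := by
  refine ⟨⟨Function.update l.parts p (j + 1), ?_, ?_⟩, ?_⟩
  · intro a b hab
    have hanti := l.anti hab
    by_cases ha : a = p <;> by_cases hb : b = p <;> simp only [ha, hb, Function.update_self,
      Function.update_of_ne, ne_eq, not_false_eq_true, le_refl]
    · subst ha; omega
    · subst hb; exact h a (lt_of_le_of_ne hab ha)
    · exact hanti
  · intro a
    by_cases ha : a = p
    · subst ha; simp only [Function.update_self]; exact j.2
    · simpa [ha] using l.le a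
  · rw [move_true_iff]
    refine ⟨by simp [hp], fun a b => ?_⟩
    by_cases ha : a = p
    · subst ha; simp only [Function.update_self, Fin.rev_rev, Fin.ext_iff, true_and]; omega
    · simp [ha]

theorem exists_move_remove (l : Diagram n m) (p : Fin n) (j : Fin m) (hp : l.parts p = j + 1)
    (h : ∀ q, p < q → l.parts q ≤ j) : ∃ μ, Move ⟨false, p.rev, j⟩ l μ := by
  refine ⟨⟨Function.update l.parts p j, ?_, ?_⟩, ?_⟩
  · intro a b hab
    have hanti := l.anti hab
    by_cases ha : a = p <;> by_cases hb : b = p <;> simp only [ha, hb, Function.update_self,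
      Function.update_of_ne, ne_eq, not_false_eq_true, le_refl]
    · subst ha; exact h b (lt_of_le_of_ne hab (Ne.symm hb))
    · subst hb; omega
    · exact hanti
  · intro a
    by_cases ha : a = p
    · subst ha; simp only [Function.update_self]; exact j.2.le
    · simpa [ha] using l.le a
  · rw [move_false_iff, move_true_iff]
    refine ⟨by simp, fun a b => ?_⟩
    by_cases ha : a = p
    · subst ha; simp only [Function.update_self, Fin.rev_rev, Fin.ext_iff, true_and]; omega
    · simp [ha]

/-- `Move` does not mention corners: that the box is next in its row is forced by `μ` being
left-justified. -/
theorem parts_eq_of_move {i : Fin n} {j : Fin m} {l μ : Diagram n m}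
    (h : Move ⟨true, i, j⟩ l μ) :
    l.parts i.rev = j ∧ μ.parts = Function.update l.parts i.rev (j + 1) := by
  rw [move_true_iff] at h
  obtain ⟨h1, h2⟩ := h
  have hj : l.parts i.rev = j := by
    by_contra hne
    have hlt : l.parts i.rev < j := lt_of_le_of_ne h1 hne
    have h3 := (h2 i.rev j).2 (Or.inl ⟨rfl, rfl⟩)
    rcases (h2 i.rev ⟨l.parts i.rev, hlt.trans j.2⟩).1 (hlt.trans h3) with ⟨-, h4⟩ | h4
    · exact hne (congrArg Fin.val h4)
    · exact lt_irrefl _ h4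
  refine ⟨hj, funext fun p => ?_⟩
  have hμ := μ.le p
  have hl := l.le p
  by_cases hp : p = i.rev
  · subst hp
    rw [Function.update_self]
    have h3 := (h2 i.rev j).2 (Or.inl ⟨rfl, rfl⟩)
    by_contra hne
    rcases (h2 i.rev ⟨j + 1, by omega⟩).1 (by simp only; omega) with ⟨-, h4⟩ | h4
    · have := congrArg Fin.val h4
      simp only at this
      omega
    · simp only at h4
      omega
  · rw [Function.update_of_ne hp]
    rcases lt_trichotomy (μ.parts p) (l.parts p) with h3 | h3 | h3
    · have := h2 p ⟨μ.parts p, by omega⟩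
      simp only [hp, false_and, false_or] at this
      omega
    · exact h3
    · have := h2 p ⟨l.parts p, by omega⟩
      simp only [hp, false_and, false_or] at this
      omega

theorem conj_eq_of_move {i : Fin n} {j : Fin m} {l μ : Diagram n m}
    (h : Move ⟨true, i, j⟩ l μ) :
    l.conj j = i.rev ∧ μ.conj = Function.update l.conj j (i.rev + 1) := by
  obtain ⟨h1, h2⟩ := parts_eq_of_move h
  rw [move_true_iff] at h
  have hb : ∀ p : Fin n, (j : ℕ) < μ.parts p ↔ p ≤ i.rev := by
    intro p
    constructor
    · intro hp
      by_contra hc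
      have := l.anti (not_le.1 hc).le
      rw [h2, Function.update_of_ne (not_le.1 hc).ne'] at hp
      omega
    · intro hp
      have := μ.anti hp
      rw [h2, Function.update_self] at this
      rw [h2]
      omega
  refine ⟨conj_eq_of_forall _ _ i.rev.2.le fun p => ?_, funext fun q => ?_⟩
  · by_cases hp : p = i.rev
    · subst hp; omega
    · have := h.2 p j
      simp only [hp, false_and, false_or] at this
      rw [← this, hb, Fin.val_fin_lt]
      exact ⟨fun h => h.le, fun h => lt_of_le_of_ne h hp⟩
  · by_cases hq : q = j
    · subst hq
      rw [Function.update_self]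
      exact conj_eq_of_forall _ _ i.rev.2 fun p => by rw [hb, Fin.le_def]; omega
    · rw [Function.update_of_ne hq]
      exact conj_eq_of_forall _ _ (l.conj_le q) fun p => by simp [h.2 p q, hq, lt_conj_iff]

theorem mem_wall_iff (α : IsoRoot n m) (Λ : Wt n m) :
    Λ ∈ wall α ↔ Λ.1 α.i - Λ.2 α.j = if α.pos then 0 else (n : ℤ) - (m : ℤ) := by
  rw [← form_root]; rfl

/-- At the added corner both coordinates equal `m·i.rev + n·j`; the part and the column height each
grow by one. -/
theorem move_true_spec {i : Fin n} {j : Fin m} {l μ : Diagram n m}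
    (h : Move ⟨true, i, j⟩ l μ) :
    l.x ∈ wall ⟨true, i, j⟩ ∧ μ.x = l.x + shift ⟨true, i, j⟩ := by
  obtain ⟨h1, h2⟩ := parts_eq_of_move h
  obtain ⟨h3, h4⟩ := conj_eq_of_move h
  refine ⟨?_, Prod.ext (funext fun a => ?_) (funext fun b => ?_)⟩
  · rw [mem_wall_iff, x_fst, x_snd]
    simp only [h1, h3, if_true]
    ring
  · rw [Prod.fst_add, Pi.add_apply, x_fst, x_fst, h2]
    by_cases ha : a = i
    · subst ha
      simp [shift, Wt.eps, Wt.del, h1]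
      ring
    · simp [shift, Wt.eps, Wt.del, ha]
  · rw [Prod.snd_add, Pi.add_apply, x_snd, x_snd, h4]
    by_cases hb : b = j
    · subst hb
      simp [shift, Wt.eps, Wt.del, h3]
      ring
    · simp [shift, Wt.eps, Wt.del, hb]

theorem move_spec {α : IsoRoot n m} {l μ : Diagram n m} (h : Move α l μ) :
    l.x ∈ wall α ∧ μ.x = l.x + shift α := by
  obtain ⟨b, i, j⟩ := α
  cases b
  · obtain ⟨h1, h2⟩ := move_true_spec ((move_false_iff i j l μ).1 h)
    have h3 : shift (⟨false, i, j⟩ : IsoRoot n m) = -shift ⟨true, i, j⟩ :=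
      shift_neg ⟨true, i, j⟩
    have h4 : μ.x + shift ⟨true, i, j⟩ ∈ wall (-(⟨true, i, j⟩ : IsoRoot n m)) := add_shift_mem h1
    exact ⟨by rw [h2]; exact h4, by rw [h2, h3, add_neg_cancel_right]⟩
  · exact move_true_spec h

/-- Addition of a full lowest row to a diagram whose top row is empty. -/
def addRow (l : Diagram n m) : Diagram n m where
  parts p := if h : (p : ℕ) = 0 then m else l.parts ⟨p - 1, by omega⟩
  anti p q hpq := by
    have hpq' : (p : ℕ) ≤ q := hpq
    beta_reduce
    split_ifs with h1 h2
    · exact le_rfl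
    · omega
    · exact l.le _
    · exact l.anti (Fin.mk_le_mk.2 (by omega))
  le p := by
    split_ifs
    · exact le_rfl
    · exact l.le _

theorem delRow_addRow (l : Diagram n m) (h : ∀ p : Fin n, (p : ℕ) + 1 = n → l.parts p = 0) :
    l.addRow.delRow = l := by
  refine Diagram.ext (funext fun p => ?_)
  by_cases hp : (p : ℕ) + 1 < n
  · simp [delRow, addRow, hp]
  · simp [delRow, hp, h p (by omega)]

theorem parts_zero_addRow [NeZero n] (l : Diagram n m) : l.addRow.parts 0 = m := by
  simp [addRow]

/-- Addition of a full first column to a diagram whose last column is empty. -/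
def addCol (l : Diagram n m) (h : ∀ p, l.parts p < m) : Diagram n m where
  parts p := l.parts p + 1
  anti _ _ hpq := Nat.add_le_add_right (l.anti hpq) 1
  le p := h p

theorem delCol_addCol (l : Diagram n m) (h : ∀ p, l.parts p < m) :
    (l.addCol h).delCol = l := rfl

theorem conj_zero_addCol [NeZero m] (l : Diagram n m) (h : ∀ p, l.parts p < m) :
    (l.addCol h).conj 0 = n :=
  conj_eq_of_forall _ _ le_rfl fun p => by simp [addCol]

end Diagram

/-! ### The rotations `ν`, `η` of weights and roots, and their compatibility with walls and shifts.
-/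

section Rotations

variable {n m : ℕ}

theorem finRotate_val (i : Fin n) (h : (i : ℕ) + 1 < n) : (finRotate n i : ℕ) = i + 1 := by
  obtain _ | n := n
  · exact i.elim0
  · exact coe_finRotate_of_ne_last (by rintro rfl; simp at h)

theorem finRotate_val_last (i : Fin n) (h : (i : ℕ) + 1 = n) : (finRotate n i : ℕ) = 0 := by
  obtain _ | n := n
  · exact i.elim0
  · have : i = Fin.last n := Fin.ext (by simp only [Fin.val_last]; omega)
    rw [this, finRotate_last]; rfl

theorem finRotate_pow_val (d : ℕ) (i : Fin n) : ((finRotate n ^ d) i : ℕ) = (i + d) % n := by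
  induction d with
  | zero => simp [Nat.mod_eq_of_lt i.2]
  | succ d ih =>
    rw [pow_succ', Equiv.Perm.mul_apply]
    set k := (finRotate n ^ d) i
    rcases Nat.lt_or_ge ((k : ℕ) + 1) n with h | h
    · rw [finRotate_val _ h, ih, ← Nat.add_assoc, Nat.add_mod (i + d) 1 n]
      rw [ih] at h
      have h1 : 1 % n = 1 := Nat.mod_eq_of_lt (by omega)
      rw [h1, Nat.mod_eq_of_lt h]
    · have h' : (k : ℕ) + 1 = n := by have := k.2; omega
      rw [finRotate_val_last _ h']
      rw [ih] at h'
      rw [← Nat.add_assoc, ← Nat.mod_add_mod, h', Nat.mod_self]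

theorem finRotate_pow_self : finRotate n ^ n = 1 :=
  Equiv.ext fun i => Fin.ext <| by
    rw [finRotate_pow_val, Nat.add_mod_right, Nat.mod_eq_of_lt i.2]; rfl

theorem Wt.nu_fst (Λ : Wt n m) (i : Fin n) :
    (Wt.nu n m Λ).1 (finRotate n i) = Λ.1 i := by
  change Λ.1 ((finRotate n).symm (finRotate n i)) = _
  rw [Equiv.symm_apply_apply]

theorem Wt.nu_snd (Λ : Wt n m) : (Wt.nu n m Λ).2 = Λ.2 := rfl

theorem Wt.eta_fst (Λ : Wt n m) : (Wt.eta n m Λ).1 = Λ.1 := rfl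

theorem Wt.eta_snd (Λ : Wt n m) (j : Fin m) :
    (Wt.eta n m Λ).2 j = Λ.2 (finRotate m j) := rfl

theorem Wt.nu_pow_fst (d : ℕ) (Λ : Wt n m) (i : Fin n) :
    ((Wt.nu n m ^ d) Λ).1 ((finRotate n ^ d) i) = Λ.1 i := by
  induction d with
  | zero => rfl
  | succ d ih => rw [pow_succ', pow_succ', Equiv.Perm.mul_apply, Equiv.Perm.mul_apply, nu_fst, ih]

theorem Wt.nu_pow_snd (d : ℕ) (Λ : Wt n m) : ((Wt.nu n m ^ d) Λ).2 = Λ.2 := by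
  induction d with
  | zero => rfl
  | succ d ih => rw [pow_succ', Equiv.Perm.mul_apply, nu_snd, ih]

theorem Wt.eta_pow_fst (d : ℕ) (Λ : Wt n m) : ((Wt.eta n m ^ d) Λ).1 = Λ.1 := by
  induction d with
  | zero => rfl
  | succ d ih => rw [pow_succ', Equiv.Perm.mul_apply, eta_fst, ih]

theorem Wt.eta_pow_snd (d : ℕ) (Λ : Wt n m) (j : Fin m) :
    ((Wt.eta n m ^ d) Λ).2 j = Λ.2 ((finRotate m ^ d) j) := by
  induction d generalizing j with
  | zero => rfl
  | succ d ih => rw [pow_succ', Equiv.Perm.mul_apply, eta_snd, ih, pow_succ, Equiv.Perm.mul_apply]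

theorem Wt.nu_pow_self : Wt.nu n m ^ n = 1 := by
  refine Equiv.ext fun Λ => Prod.ext (funext fun i => ?_) (nu_pow_snd n Λ)
  have h := nu_pow_fst n Λ i
  rw [finRotate_pow_self] at h
  exact h

theorem Wt.eta_pow_self : Wt.eta n m ^ m = 1 := by
  refine Equiv.ext fun Λ => Prod.ext (eta_pow_fst m Λ) (funext fun j => ?_)
  rw [eta_pow_snd, finRotate_pow_self]
  rfl

theorem Wt.commute_eta_nu : Commute (Wt.eta n m) (Wt.nu n m) := rfl

theorem commute_etaRoot_nuRoot : Commute (etaRoot n m) (nuRoot n m) := rfl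

theorem mem_wall_iff_add_const (α : IsoRoot n m) (Λ : Wt n m) (c : ℤ) :
    Λ + Wt.const c ∈ wall α ↔ Λ ∈ wall α := by
  rw [Diagram.mem_wall_iff, Diagram.mem_wall_iff]
  simp [Wt.const]

theorem shift_fst (α : IsoRoot n m) (i : Fin n) :
    (shift α).1 i = if i = α.i then (if α.pos then (n : ℤ) else -n) else 0 := by
  unfold shift
  cases α.pos <;> by_cases h : i = α.i <;> simp [Wt.eps, Wt.del, h]

theorem shift_snd (α : IsoRoot n m) (j : Fin m) :
    (shift α).2 j = if j = α.j then (if α.pos then (m : ℤ) else -m) else 0 := by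
  unfold shift
  cases α.pos <;> by_cases h : j = α.j <;> simp [Wt.eps, Wt.del, h]

/-- The pairs of a permutation of the weights and a permutation of the roots that are compatible
with the addition, the constant vectors, the walls and the shifts. -/
def compatibleRotations (n m : ℕ) : Subgroup (Equiv.Perm (Wt n m) × Equiv.Perm (IsoRoot n m)) where
  carrier := {g | (∀ Λ M, g.1 (Λ + M) = g.1 Λ + g.1 M) ∧ (∀ c, g.1 (Wt.const c) = Wt.const c) ∧
    (∀ α, g.1 (shift α) = shift (g.2 α)) ∧ ∀ α Λ, g.1 Λ ∈ wall (g.2 α) ↔ Λ ∈ wall α}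
  mul_mem' := by
    rintro g h ⟨g1, g2, g3, g4⟩ ⟨h1, h2, h3, h4⟩
    refine ⟨fun Λ M => ?_, fun c => ?_, fun α => ?_, fun α Λ => ?_⟩
    · simp [h1, g1]
    · simp [h2, g2]
    · simp [h3, g3]
    · simp [h4, g4]
  one_mem' := ⟨fun _ _ => rfl, fun _ => rfl, fun _ => rfl, fun _ _ => Iff.rfl⟩
  inv_mem' := by
    rintro g ⟨g1, g2, g3, g4⟩
    refine ⟨fun Λ M => ?_, fun c => ?_, fun α => ?_, fun α Λ => ?_⟩
    · simp [Equiv.symm_apply_eq, g1]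
    · simp [Equiv.symm_apply_eq, g2]
    · simp [Equiv.symm_apply_eq, g3]
    · simpa using (g4 (g.2.symm α) (g.1.symm Λ)).symm

theorem nu_mem_compatibleRotations : (Wt.nu n m, nuRoot n m) ∈ compatibleRotations n m := by
  refine ⟨fun _ _ => rfl, fun _ => rfl, fun α => ?_, fun α Λ => ?_⟩
  · refine Prod.ext (funext fun i => ?_) ?_
    · obtain ⟨i, rfl⟩ := (finRotate n).surjective i
      change _ = (shift (nuRoot n m α)).1 _
      rw [Wt.nu_fst, shift_fst, shift_fst]
      exact if_congr (finRotate n).injective.eq_iff.symm rfl rfl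
    · change _ = (shift (nuRoot n m α)).2
      funext j
      rw [Wt.nu_snd, shift_snd, shift_snd]
      rfl
  · rw [Diagram.mem_wall_iff, Diagram.mem_wall_iff]
    change (Wt.nu n m Λ).1 (finRotate n α.i) - (Wt.nu n m Λ).2 α.j = _ ↔ _
    rw [Wt.nu_fst, Wt.nu_snd]
    rfl

theorem eta_mem_compatibleRotations : (Wt.eta n m, etaRoot n m) ∈ compatibleRotations n m := by
  refine ⟨fun _ _ => rfl, fun _ => rfl, fun α => ?_, fun α Λ => ?_⟩
  · refine Prod.ext ?_ (funext fun j => ?_)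
    · change _ = (shift (etaRoot n m α)).1
      funext i
      rw [Wt.eta_fst, shift_fst, shift_fst]
      rfl
    · change _ = (shift (etaRoot n m α)).2 _
      rw [Wt.eta_snd, shift_snd, shift_snd]
      exact if_congr (Equiv.eq_symm_apply _).symm rfl rfl
  · rw [Diagram.mem_wall_iff, Diagram.mem_wall_iff]
    change (Wt.eta n m Λ).1 α.i - (Wt.eta n m Λ).2 ((finRotate m).symm α.j) = _ ↔ _
    rw [Wt.eta_fst, Wt.eta_snd, Equiv.apply_symm_apply]
    rfl

theorem rotation_mem_compatibleRotations (i j : ℤ) :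
    (Wt.eta n m ^ i * Wt.nu n m ^ j, etaRoot n m ^ i * nuRoot n m ^ j)
      ∈ compatibleRotations n m :=
  mul_mem (zpow_mem eta_mem_compatibleRotations i) (zpow_mem nu_mem_compatibleRotations j)

theorem rotation_add (i j : ℤ) (Λ M : Wt n m) : (Wt.eta n m ^ i * Wt.nu n m ^ j) (Λ + M)
    = (Wt.eta n m ^ i * Wt.nu n m ^ j) Λ + (Wt.eta n m ^ i * Wt.nu n m ^ j) M :=
  (rotation_mem_compatibleRotations i j).1 Λ M

theorem rotation_const (i j c : ℤ) :
    (Wt.eta n m ^ i * Wt.nu n m ^ j) (Wt.const c) = Wt.const c :=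
  (rotation_mem_compatibleRotations i j).2.1 c

theorem rootRotation_neg_apply (i j : ℤ) (α : IsoRoot n m) :
    (etaRoot n m ^ (-i) * nuRoot n m ^ (-j)) ((etaRoot n m ^ i * nuRoot n m ^ j) α) = α := by
  rw [← Equiv.Perm.mul_apply, (commute_etaRoot_nuRoot.zpow_zpow i j).eq, mul_assoc,
    ← mul_assoc (nuRoot n m ^ (-j)), zpow_neg, zpow_neg, inv_mul_cancel, one_mul, inv_mul_cancel]
  rfl

/-- Matches the exponents `-i`, `-j` of `x̂` with the exponents `i`, `j` on the roots in the
definition of `𝔽`. -/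
theorem rotation_neg_mem_wall_iff (i j : ℤ) (α : IsoRoot n m) (Λ : Wt n m) :
    (Wt.eta n m ^ (-i) * Wt.nu n m ^ (-j)) Λ ∈ wall α
      ↔ Λ ∈ wall ((etaRoot n m ^ i * nuRoot n m ^ j) α) := by
  have h := (rotation_mem_compatibleRotations (-i) (-j)).2.2.2
    ((etaRoot n m ^ i * nuRoot n m ^ j) α) Λ
  simp only [rootRotation_neg_apply] at h
  exact h

theorem rotation_neg_shift (i j : ℤ) (α : IsoRoot n m) :
    (Wt.eta n m ^ (-i) * Wt.nu n m ^ (-j)) (shift ((etaRoot n m ^ i * nuRoot n m ^ j) α))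
      = shift α := by
  have h := (rotation_mem_compatibleRotations (-i) (-j)).2.2.1
    ((etaRoot n m ^ i * nuRoot n m ^ j) α)
  simp only [rootRotation_neg_apply] at h
  exact h

end Rotations

/-! ### Deletion of full rows and columns, and the passage from walls to moves. -/

theorem Cls.mk_delRow {n m : ℕ} [NeZero n] [NeZero m] (l : Diagram n m) (k : ℤ)
    (h : l.parts 0 = m) : Cls.mk l k = Cls.mk l.delRow (k + m) :=
  Quotient.sound (.rel _ _ (.row l k h))

theorem Cls.mk_delCol {n m : ℕ} [NeZero n] [NeZero m] (l : Diagram n m) (k : ℤ)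
    (h : l.conj 0 = n) : Cls.mk l k = Cls.mk l.delCol (k + n) :=
  Quotient.sound (.rel _ _ (.col l k h))

namespace Diagram

variable {n m : ℕ}

/-- Every remaining row moves down by one, which costs `m`, and every column loses one box, which
also costs `m`. The full bottom row has coordinate `nm = m(n-1) + m`, matching the new empty top
row. -/
theorem x_delRow [NeZero n] (l : Diagram n m) (h : l.parts 0 = m) :
    Wt.nu n m l.x = l.delRow.x + Wt.const m := by
  refine Prod.ext (funext fun i => ?_) (funext fun j => ?_)
  · obtain ⟨i, rfl⟩ := (finRotate n).surjective i
    rw [Wt.nu_fst, x_fst, Prod.fst_add, Pi.add_apply, x_fst]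
    simp only [Wt.const]
    rcases Nat.lt_or_ge ((i : ℕ) + 1) n with hi | hi
    · have hr := finRotate_val i hi
      have h1 : (i.rev : ℕ) = (finRotate n i).rev + 1 := by
        simp only [Fin.val_rev, hr]; omega
      have h2 : l.delRow.parts (finRotate n i).rev = l.parts i.rev := by
        have : ((finRotate n i).rev : ℕ) + 1 < n := by have := i.rev.2; omega
        simp only [delRow, this, dif_pos]
        exact congrArg _ (Fin.ext h1.symm)
      rw [h1, h2]
      push_cast
      ring
    · have hi' : (i : ℕ) + 1 = n := by omega
      have hr := finRotate_val_last i hi'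
      have h1 : i.rev = 0 := Fin.ext (by simp only [Fin.val_rev, Fin.val_zero]; omega)
      have h2 : ((finRotate n i).rev : ℕ) + 1 = n := by
        simp only [Fin.val_rev, hr]; omega
      have h3 : l.delRow.parts (finRotate n i).rev = 0 := by
        simp only [delRow, h2, lt_irrefl, dif_neg, not_false_eq_true]
      have h4 : (((finRotate n i).rev : ℕ) : ℤ) = n - 1 := by omega
      rw [h1, h3, h, h4]
      simp
      ring
  · rw [Wt.nu_snd, x_snd, Prod.snd_add, Pi.add_apply, x_snd]
    have hc : l.conj j = l.delRow.conj j + 1 := by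
      have h0 : 0 < l.conj j := by
        have := l.lt_conj_iff 0 j
        rw [h] at this
        exact this.2 j.2
      have : l.delRow.conj j = l.conj j - 1 :=
        conj_eq_of_forall _ _ ((Nat.sub_le _ _).trans (l.conj_le j)) fun p => by
          by_cases hp : (p : ℕ) + 1 < n
          · simp only [delRow, hp, dif_pos]
            rw [← lt_conj_iff]
            simp only
            omega
          · have := l.conj_le j
            simp only [delRow, hp, dif_neg, not_false_eq_true]
            omega
      omega
    rw [hc]
    simp [Wt.const]
    ring

/-- The dual computation: the full first column has coordinate `mn = n(m-1) + n` and becomes the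
empty last column. -/
theorem x_delCol [NeZero m] (l : Diagram n m) (h : l.conj 0 = n) :
    Wt.eta n m l.x = l.delCol.x + Wt.const n := by
  have hpos : ∀ p, 0 < l.parts p := fun p => by
    have := l.lt_conj_iff p 0
    rw [h] at this
    exact this.1 p.2
  refine Prod.ext (funext fun i => ?_) (funext fun j => ?_)
  · rw [Wt.eta_fst, x_fst, Prod.fst_add, Pi.add_apply, x_fst]
    have h1 : l.parts i.rev = l.delCol.parts i.rev + 1 := by
      have := hpos i.rev
      simp only [delCol]
      omega
    rw [h1]
    simp [Wt.const]
    ring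
  · rw [Wt.eta_snd, x_snd, Prod.snd_add, Pi.add_apply, x_snd]
    simp only [Wt.const]
    rcases Nat.lt_or_ge ((j : ℕ) + 1) m with hj | hj
    · have hr := finRotate_val j hj
      have hc : l.delCol.conj j = l.conj (finRotate m j) :=
        conj_eq_of_forall _ _ (l.conj_le _) fun p => by
          rw [lt_conj_iff, hr]
          simp only [delCol]
          omega
      rw [hc, hr]
      push_cast
      ring
    · have hj' : (j : ℕ) + 1 = m := by have := j.2; omega
      have hr := finRotate_val_last j hj'
      have hr' : finRotate m j = 0 := Fin.ext hr
      have hc : l.delCol.conj j = 0 :=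
        conj_eq_of_forall _ _ (Nat.zero_le _) fun p => by
          have := l.le p
          simp only [delCol]
          omega
      have hj2 : ((j : ℕ) : ℤ) = m - 1 := by omega
      rw [hr', hc, h, hj2]
      simp
      ring

/-- If `x(λ)` lies on the wall of `α`, then `t_β` is defined at some representative of the class
of `λ`, where `β` is the correspondingly rotated root. -/
theorem exists_move_of_mem_wall [NeZero n] [NeZero m] (hmn : Nat.Coprime m n) (α : IsoRoot n m)
    (l : Diagram n m) (h : l.x ∈ wall α) :
    ∃ (e : ℤ) (l' μ : Diagram n m), (∀ k, Cls.mk l k = Cls.mk l' (k + e * m)) ∧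
      Move ((nuRoot n m ^ e) α) l' μ := by
  have hn : (0 : ℤ) < n := by exact_mod_cast NeZero.pos n
  have hm : (0 : ℤ) < m := by exact_mod_cast NeZero.pos m
  have hcop : IsCoprime (n : ℤ) (m : ℤ) := Nat.isCoprime_iff_coprime.2 hmn.symm
  obtain ⟨b, i, j⟩ := α
  rw [mem_wall_iff, x_fst, x_snd] at h
  have hc := l.conj_le j
  have hl := l.le i.rev
  have hi := i.rev.2
  have hj := j.2
  cases b
  · simp only [Bool.false_eq_true, if_false] at h
    -- By coprimality the two brackets are `n·t` and `m·t`; the bounds of the rectangle leave `t =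
    -- 0`, an inner corner, or `t = 1`.
    have h1 : (m : ℤ) * ((i.rev : ℕ) + 1 - l.conj j) = n * (j + 1 - l.parts i.rev) := by
      linarith
    obtain ⟨t, ht⟩ := hcop.dvd_of_dvd_mul_left (Dvd.intro _ h1.symm)
    have h2 : (j : ℤ) + 1 - l.parts i.rev = m * t := by
      rw [ht] at h1
      have : (n : ℤ) * (j + 1 - l.parts i.rev) = n * (m * t) := by linarith
      exact mul_left_cancel₀ hn.ne' this
    have ht1 : t ≤ 1 := by
      by_contra hc; have : n * 2 ≤ n * t := mul_le_mul_of_nonneg_left (by omega) hn.le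
      omega
    have ht0 : 0 ≤ t := by
      by_contra hc; have : n * t ≤ n * (-1) := mul_le_mul_of_nonneg_left (by omega) hn.le
      omega
    obtain rfl | rfl : t = 0 ∨ t = 1 := by omega
    · obtain ⟨μ, hμ⟩ := l.exists_move_remove i.rev j (by omega) fun q hq => by
        have := l.lt_conj_iff q j
        rw [Fin.lt_def] at hq
        omega
      exact ⟨0, l, μ, by simp, by simpa using hμ⟩
    -- Here the top row and the last column are empty. After a full bottom row is added, its last
    -- box is removable, in row `ε_n` instead of `ε_1`; hence the exponent `-1`.
    · have hz : ∀ p : Fin n, (p : ℕ) + 1 = n → l.parts p = 0 := fun p hp => by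
        have : p = i.rev := Fin.ext (by omega)
        rw [this]; omega
      have hi0 : (i : ℕ) = 0 := by
        have := Fin.val_rev i
        omega
      obtain ⟨μ, hμ⟩ := l.addRow.exists_move_remove 0 j
        (by rw [parts_zero_addRow]; omega) fun q hq => by
        have hq' : (q : ℕ) ≠ 0 := fun h => hq.ne' (Fin.ext h)
        simp only [addRow, hq', dif_neg, not_false_eq_true]
        have := l.lt_conj_iff ⟨q - 1, by omega⟩ j
        omega
      refine ⟨-1, l.addRow, μ, fun k => ?_, ?_⟩
      · rw [Cls.mk_delRow l.addRow _ l.parts_zero_addRow, l.delRow_addRow hz]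
        congr 1
        ring
      · have : (nuRoot n m ^ (-1 : ℤ)) ⟨false, i, j⟩ = ⟨false, (0 : Fin n).rev, j⟩ := by
          rw [zpow_neg_one, Equiv.Perm.inv_eq_iff_eq]
          refine IsoRoot.ext rfl (Fin.ext ?_) rfl
          have := finRotate_val_last (0 : Fin n).rev (by simp [Fin.val_rev]; omega)
          exact hi0.trans this.symm
        rw [this]
        exact hμ
  · simp only [if_true] at h
    have h1 : (m : ℤ) * ((i.rev : ℕ) - l.conj j) = n * (j - l.parts i.rev) := by
      linarith
    obtain ⟨t, ht⟩ := hcop.dvd_of_dvd_mul_left (Dvd.intro _ h1.symm)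
    have h2 : (j : ℤ) - l.parts i.rev = m * t := by
      rw [ht] at h1
      have : (n : ℤ) * (j - l.parts i.rev) = n * (m * t) := by linarith
      exact mul_left_cancel₀ hn.ne' this
    have ht1 : t ≤ 0 := by
      by_contra hc; have : n * 1 ≤ n * t := mul_le_mul_of_nonneg_left (by omega) hn.le
      omega
    have ht0 : -1 ≤ t := by
      by_contra hc; have : n * t ≤ n * (-2) := mul_le_mul_of_nonneg_left (by omega) hn.le
      omega
    obtain rfl | rfl : t = 0 ∨ t = -1 := by omega
    · obtain ⟨μ, hμ⟩ := l.exists_move_add i.rev j (by omega) fun q hq => by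
        have := l.lt_conj_iff q j
        rw [Fin.lt_def] at hq
        omega
      exact ⟨0, l, μ, by simp, by simpa using hμ⟩
    -- Here the bottom row and the first column are full. After the bottom row is deleted, the first
    -- box of the top row can be added, in row `ε_1` instead of `ε_n`.
    · have hi0 : (i : ℕ) + 1 = n := by
        have := Fin.val_rev i
        omega
      have hr0 : i.rev = 0 := Fin.ext (by rw [Fin.val_zero]; omega)
      have hfull : l.parts 0 = m := by rw [← hr0]; omega
      have hrot := finRotate_val_last i hi0
      have hrev : ((finRotate n i).rev : ℕ) + 1 = n := by rw [Fin.val_rev, hrot]; omega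
      obtain ⟨μ, hμ⟩ := l.delRow.exists_move_add (finRotate n i).rev j
        (by simp only [delRow, hrev, lt_irrefl, dif_neg, not_false_eq_true]; omega) fun q hq => by
        rw [Fin.lt_def] at hq
        have hq' : (q : ℕ) + 1 < n := by omega
        simp only [delRow, hq', dif_pos]
        rw [← lt_conj_iff]
        simp only
        omega
      refine ⟨1, l.delRow, μ, fun k => ?_, ?_⟩
      · rw [one_mul, Cls.mk_delRow l k hfull]
      · rw [Fin.rev_rev] at hμ
        rw [zpow_one]
        exact hμ

end Diagram

/-! ### Transport of groupoid actions along bijections, and transitivity on an orbit. -/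

section Actions

universe u v w w'

variable {G : Type u} [Groupoid.{v} G] {U : Type w} {V : Type w'}

theorem functor_symGpd_ext {F F' : G ⥤ SymGpd V}
    (hobj : ∀ a, (F.obj a).carrier = (F'.obj a).carrier)
    (hmap : ∀ {a b : G} (s : a ⟶ b) (x : V) (hx : x ∈ (F.obj a).carrier)
      (hx' : x ∈ (F'.obj a).carrier),
      (SymGpd.toEquiv (F.map s) ⟨x, hx⟩ : V) = SymGpd.toEquiv (F'.map s) ⟨x, hx'⟩) : F = F' := by
  obtain ⟨o, f, h1, h2⟩ := F
  obtain ⟨o', f', h1', h2'⟩ := F'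
  obtain rfl : o = o' := funext fun a => SymGpd.ext (hobj a)
  obtain rfl : @f = @f' := by
    funext a b s
    exact Equiv.ext fun y => Subtype.ext (hmap s y.1 y.2 y.2)
  rfl

/-- The transport of an action along a bijection. -/
def transportAction (e : U ≃ V) (F : G ⥤ SymGpd V) : G ⥤ SymGpd U where
  obj a := ⟨e ⁻¹' (F.obj a).carrier⟩
  map {a b} s := ((e.subtypeEquiv fun _ => Iff.rfl : ↥(e ⁻¹' (F.obj a).carrier) ≃ _).trans
    (SymGpd.toEquiv (F.map s))).trans
      (e.subtypeEquiv fun _ => Iff.rfl : ↥(e ⁻¹' (F.obj b).carrier) ≃ _).symm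
  map_id a := Equiv.ext fun y => Subtype.ext <| e.injective <| by
    simp only [Equiv.trans_apply, F.map_id]
    exact e.apply_symm_apply _
  map_comp s t := Equiv.ext fun y => Subtype.ext <| e.injective <| by
    simp only [Equiv.trans_apply, F.map_comp]
    refine (e.apply_symm_apply _).trans (Eq.trans ?_ (e.apply_symm_apply _).symm)
    refine congrArg (fun z => (SymGpd.toEquiv (F.map t) z).1) (Subtype.ext ?_)
    exact (e.apply_symm_apply _).symm

theorem transportAction_map (e : U ≃ V) (F : G ⥤ SymGpd V) {a b : G} (s : a ⟶ b)
    (y : ((transportAction e F).obj a).carrier) :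
    e (SymGpd.toEquiv ((transportAction e F).map s) y)
      = SymGpd.toEquiv (F.map s) ⟨e y.1, y.2⟩ :=
  e.apply_symm_apply _

theorem cayleyGraph_transportAction (e : U ≃ V) (F : G ⥤ SymGpd V) (x y : U) :
    (cayleyGraph F).Adj (e x) (e y) ↔ (cayleyGraph (transportAction e F)).Adj x y := by
  constructor
  · rintro ⟨a, b, s, hx, h⟩
    exact ⟨a, b, s, hx, e.injective ((transportAction_map e F s ⟨x, hx⟩).trans h)⟩
  · rintro ⟨a, b, s, hx, h⟩
    exact ⟨a, b, s, hx, (transportAction_map e F s ⟨x, hx⟩).symm.trans (congrArg e h)⟩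

theorem isTransitiveAction_iff (F : G ⥤ SymGpd V) :
    IsTransitiveAction F ↔ ∃ x, ∀ y, Relation.EqvGen (cayleyGraph F).Adj x y :=
  exists_congr fun _ => Set.eq_univ_iff_forall

theorem isTransitiveAction_transportAction (e : U ≃ V) (F : G ⥤ SymGpd V)
    (h : IsTransitiveAction F) : IsTransitiveAction (transportAction e F) := by
  rw [isTransitiveAction_iff] at h ⊢
  obtain ⟨x, hx⟩ := h
  have key : ∀ y z, Relation.EqvGen (cayleyGraph F).Adj y z →
      Relation.EqvGen (cayleyGraph (transportAction e F)).Adj (e.symm y) (e.symm z) := by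
    intro y z h
    induction h with
    | rel y z h =>
      refine .rel _ _ ((cayleyGraph_transportAction e F _ _).1 ?_)
      simpa using h
    | refl => exact .refl _
    | symm _ _ _ ih => exact ih.symm _ _
    | trans _ _ _ _ _ ih ih' => exact ih.trans _ _ _ ih'
  exact ⟨e.symm x, fun y => by simpa using key _ _ (hx (e y))⟩

theorem isTransitiveAction_restrictToOrbit (F : G ⥤ SymGpd V) (x : V) :
    IsTransitiveAction (restrictToOrbit F x) := by
  rw [isTransitiveAction_iff]
  have key : ∀ y z, Relation.EqvGen (cayleyGraph F).Adj y z → ∀ (hy : y ∈ actionOrbit F x)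
      (hz : z ∈ actionOrbit F x),
      Relation.EqvGen (cayleyGraph (restrictToOrbit F x)).Adj ⟨y, hy⟩ ⟨z, hz⟩ := by
    intro y z h
    induction h with
    | rel y z h =>
      intro hy hz
      obtain ⟨a, b, s, hs, rfl⟩ := h
      exact .rel _ _ ⟨a, b, s, hs, rfl⟩
    | refl => exact fun _ _ => .refl _
    | symm _ _ _ ih => exact fun hy hz => (ih hz hy).symm _ _
    | trans y z t h _ ih ih' =>
      intro hy ht
      -- The intermediate vertex must itself lie in the orbit for the path to be cut there.
      have hz : z ∈ actionOrbit F x := hy.trans _ _ _ h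
      exact (ih hy hz).trans _ _ _ (ih' hz ht)
  exact ⟨⟨x, .refl _⟩, fun y => key x y y.2 _ y.2⟩

theorem isEquivariantBijection_transportAction (e : U ≃ V) (F : G ⥤ SymGpd V)
    (h : IsTransitiveAction F) : IsEquivariantBijection (transportAction e F) F e where
  bijective := e.bijective
  transitive_source := isTransitiveAction_transportAction e F h
  transitive_target := h
  mem_iff _ _ := Iff.rfl
  map_eq s x hx _ := transportAction_map e F s ⟨x, hx⟩

end Actions

/-! ### Edges and invariant subsets of the Sergeev-Veselov Cayley graph. -/

section SergeevVeselovGraph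

variable {n m : ℕ}

theorem SV_map_rho (α : IsoRoot n m) (Λ : ((SV n m).obj α).carrier) :
    (SymGpd.toEquiv ((SV n m).map (rho α)) Λ : Wt n m) = Λ + shift α := by
  change ((if h : -α = α then _ else _ : wall α ≃ wall (-α)) Λ : Wt n m) = _
  rw [dif_neg α.neg_ne]
  rfl

theorem isoRoot_hom_cases {α β : IsoRoot n m} (s : α ⟶ β)
    {P : ∀ {β : IsoRoot n m}, (α ⟶ β) → Prop} (hid : P (𝟙 α)) (hrho : P (rho α)) : P s := by
  obtain ⟨rfl | rfl⟩ := s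
  · exact hid
  · exact hrho

theorem cayleyGraph_SV_adj_iff (Λ M : Wt n m) :
    (cayleyGraph (SV n m)).Adj Λ M ↔
      ∃ α : IsoRoot n m, Λ ∈ wall α ∧ (M = Λ ∨ M = Λ + shift α) := by
  constructor
  · rintro ⟨α, β, s, h, rfl⟩
    refine ⟨α, h, ?_⟩
    induction s using isoRoot_hom_cases with
    | hid => rw [(SV n m).map_id]; exact .inl rfl
    | hrho => exact .inr (SV_map_rho α ⟨Λ, h⟩)
  · rintro ⟨α, h, rfl | rfl⟩
    · exact ⟨α, α, 𝟙 α, h, by rw [(SV n m).map_id]; rfl⟩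
    · exact ⟨α, -α, rho α, h, SV_map_rho α ⟨Λ, h⟩⟩

/-- A subset that is closed under the moves of the Sergeev-Veselov action contains the orbit of
each of its elements. -/
theorem mem_of_mem_actionOrbit_SV {S : Set (Wt n m)}
    (hS : ∀ α Λ, Λ ∈ wall α → Λ ∈ S → Λ + shift α ∈ S) {Λ M : Wt n m} (hΛ : Λ ∈ S)
    (h : M ∈ actionOrbit (SV n m) Λ) : M ∈ S := by
  have key : ∀ Λ M, Relation.EqvGen (cayleyGraph (SV n m)).Adj Λ M → (Λ ∈ S ↔ M ∈ S) := by
    intro Λ M h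
    induction h with
    | rel Λ M h =>
      obtain ⟨α, hα, rfl | rfl⟩ := (cayleyGraph_SV_adj_iff Λ _).1 h
      · rfl
      · refine ⟨hS α Λ hα, fun h => ?_⟩
        -- The edge is undone by the move along `-α`, so membership also passes backwards.
        simpa [shift_neg] using hS (-α) _ (add_shift_mem hα) h
    | refl => rfl
    | symm _ _ _ ih => exact ih.symm
    | trans _ _ _ _ _ ih ih' => exact ih.trans ih'
  exact (key Λ M h).1 hΛ

end SergeevVeselovGraph

/-! ### Construction and uniqueness of `x̂`. -/

section HatX

variable {n m : ℕ}

/-- By coprimality the two pairs differ by a multiple of `(m, -n)`, and `η^m = ν^n = 1`. -/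
theorem rotation_eq_of_eq [NeZero n] [NeZero m] (hmn : Nat.Coprime m n) {i j i' j' : ℤ}
    (h : i * n + j * m = i' * n + j' * m) :
    Wt.eta n m ^ (-i) * Wt.nu n m ^ (-j) = Wt.eta n m ^ (-i') * Wt.nu n m ^ (-j') := by
  have hm : (m : ℤ) ≠ 0 := by exact_mod_cast NeZero.ne m
  have hcop : IsCoprime (m : ℤ) (n : ℤ) := Nat.isCoprime_iff_coprime.2 hmn
  have h1 : (n : ℤ) * (i - i') = m * (j' - j) := by linarith
  obtain ⟨t, ht⟩ := hcop.dvd_of_dvd_mul_left (Dvd.intro _ h1.symm)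
  have h2 : j' - j = n * t := by
    rw [ht] at h1
    exact mul_left_cancel₀ hm (by linarith)
  have hi : -i' = -i + m * t := by linarith
  have hj : -j = -j' + n * t := by linarith
  rw [hi, hj, zpow_add, zpow_add, zpow_mul, zpow_mul, zpow_natCast, zpow_natCast,
    Wt.nu_pow_self, Wt.eta_pow_self, one_zpow, mul_one, mul_one]

theorem exists_eq_mul_add_mul (hmn : Nat.Coprime m n) (k : ℤ) : ∃ i j : ℤ, k = i * n + j * m := by
  obtain ⟨a, b, h⟩ := Nat.isCoprime_iff_coprime.2 hmn.symm
  exact ⟨k * a, k * b, by linear_combination (-k) * h⟩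

theorem Wt.const_add (c d : ℤ) : (Wt.const (c + d) : Wt n m) = Wt.const c + Wt.const d := rfl

variable [NeZero n] [NeZero m]

/-- The value `η^{-i} ν^{-j} x(λ) + (k, …, k | k, …, k)` at a pair `(λ, k)` with `k = in + jm`. -/
noncomputable def hatXPair (hmn : Nat.Coprime m n) (s : Diagram n m × ℤ) : Wt n m :=
  (Wt.eta n m ^ (-(exists_eq_mul_add_mul hmn s.2).choose) *
    Wt.nu n m ^ (-(exists_eq_mul_add_mul hmn s.2).choose_spec.choose)) s.1.x + Wt.const s.2

theorem hatXPair_eq (hmn : Nat.Coprime m n) (l : Diagram n m) {i j k : ℤ}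
    (h : k = i * n + j * m) :
    hatXPair hmn (l, k) = (Wt.eta n m ^ (-i) * Wt.nu n m ^ (-j)) l.x + Wt.const k := by
  unfold hatXPair
  rw [rotation_eq_of_eq hmn
    ((exists_eq_mul_add_mul hmn k).choose_spec.choose_spec.symm.trans h)]

/-- A row step raises `j` by one and a column step raises `i` by one; the extra rotation and the
extra constant cancel by `x_delRow` and `x_delCol`. -/
theorem hatXPair_eq_of_rotStep (hmn : Nat.Coprime m n) {s t : Diagram n m × ℤ}
    (h : RotStep s t) : hatXPair hmn s = hatXPair hmn t := by
  cases h with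
  | row l k h =>
    obtain ⟨i, j, hk⟩ := exists_eq_mul_add_mul hmn k
    have hk' : k + m = i * n + (j + 1) * m := by rw [hk]; ring
    have hx : l.x = Wt.nu n m ^ (-1 : ℤ) • (l.delRow.x + Wt.const m) := by
      rw [← l.x_delRow h, zpow_neg_one]
      exact ((Wt.nu n m).symm_apply_apply _).symm
    rw [hatXPair_eq hmn l hk, hatXPair_eq hmn _ hk', hx, Equiv.Perm.smul_def,
      ← Equiv.Perm.mul_apply, mul_assoc, ← zpow_add, ← neg_add, rotation_add, rotation_const,
      Wt.const_add, add_assoc, add_comm (Wt.const k)]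
  | col l k h =>
    obtain ⟨i, j, hk⟩ := exists_eq_mul_add_mul hmn k
    have hk' : k + n = (i + 1) * n + j * m := by rw [hk]; ring
    have hx : l.x = Wt.eta n m ^ (-1 : ℤ) • (l.delCol.x + Wt.const n) := by
      rw [← l.x_delCol h, zpow_neg_one]
      exact ((Wt.eta n m).symm_apply_apply _).symm
    rw [hatXPair_eq hmn l hk, hatXPair_eq hmn _ hk', hx, Equiv.Perm.smul_def,
      ← Equiv.Perm.mul_apply, mul_assoc, ← (Wt.commute_eta_nu.zpow_zpow (-1) (-j)).eq,
      ← mul_assoc, ← zpow_add, ← neg_add, rotation_add, rotation_const,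
      Wt.const_add, add_assoc, add_comm (Wt.const k)]

/-- The map `x̂`. -/
noncomputable def hatX (hmn : Nat.Coprime m n) : Cls n m → Wt n m :=
  Quotient.lift (hatXPair hmn) fun s t h => by
    change Relation.EqvGen RotStep s t at h
    induction h with
    | rel _ _ h => exact hatXPair_eq_of_rotStep hmn h
    | refl => rfl
    | symm _ _ _ ih => exact ih.symm
    | trans _ _ _ _ _ ih ih' => exact ih.trans ih'

theorem hatX_mk (hmn : Nat.Coprime m n) (l : Diagram n m) {i j k : ℤ} (h : k = i * n + j * m) :
    hatX hmn (Cls.mk l k) = (Wt.eta n m ^ (-i) * Wt.nu n m ^ (-j)) l.x + Wt.const k :=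
  hatXPair_eq hmn l h

theorem Cls.exists_mk_eq (s : Cls n m) : ∃ l k, s = Cls.mk l k := by
  obtain ⟨⟨l, k⟩, rfl⟩ := Quotient.exists_rep s
  exact ⟨l, k, rfl⟩

theorem Cls.mk_addCol (l : Diagram n m) (k : ℤ) (h : ∀ p, l.parts p < m) :
    Cls.mk l k = Cls.mk (l.addCol h) (k - n) := by
  rw [mk_delCol _ _ (l.conj_zero_addCol h), l.delCol_addCol, sub_add_cancel]

theorem isHatX_hatX (hmn : Nat.Coprime m n) : IsHatX (hatX (n := n) hmn) := fun l i j => by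
  rw [hatX_mk hmn l rfl, Wt.const_add, add_assoc]

theorem IsHatX.unique (hmn : Nat.Coprime m n) {f g : Cls n m → Wt n m} (hf : IsHatX f)
    (hg : IsHatX g) : f = g := by
  funext s
  obtain ⟨l, k, rfl⟩ := s.exists_mk_eq
  obtain ⟨i, j, rfl⟩ := exists_eq_mul_add_mul hmn k
  rw [hf, hg]

theorem hatX_empty (hmn : Nat.Coprime m n) :
    hatX hmn (Cls.mk (Diagram.empty n m) 0) = Wt.base n m := by
  rw [hatX_mk hmn _ (show (0 : ℤ) = 0 * n + 0 * m by ring)]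
  have h : ∀ j, (Diagram.empty n m).conj j = 0 := fun j =>
    Diagram.conj_eq_of_forall _ _ (Nat.zero_le _) fun p => by simp [Diagram.empty]
  refine Prod.ext (funext fun i => ?_) (funext fun j => ?_)
  · simp [Diagram.x, Diagram.empty, Wt.const]
  · simp [Diagram.x, h, Wt.const]

/-! ### Normal forms and injectivity of `x̂`. -/

/-- Every class has a representative `(λ, k)` with `k` divisible by `n + m`. -/
theorem Cls.exists_normal_form (hmn : Nat.Coprime m n) (s : Cls n m) :
    ∃ (l : Diagram n m) (q : ℤ), s = Cls.mk l (q * n + q * m) := by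
  obtain ⟨l, k, rfl⟩ := s.exists_mk_eq
  obtain ⟨i, j, hk⟩ := exists_eq_mul_add_mul hmn k
  -- Delete a full bottom row (`+m`) or, if there is none, add a full first column (`-n`): either
  -- way the level moves by `m` modulo `n + m`.
  have key : ∀ d : ℕ, ∃ (l' : Diagram n m) (t : ℤ),
      Cls.mk l k = Cls.mk l' (k + d * m + t * (n + m)) := by
    intro d
    induction d with
    | zero => exact ⟨l, 0, by simp⟩
    | succ d ih =>
      obtain ⟨l', t, ih⟩ := ih
      rcases (l'.le 0).lt_or_eq with h | h
      · have h' : ∀ p, l'.parts p < m := fun p => (l'.anti (Fin.zero_le p)).trans_lt h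
        refine ⟨l'.addCol h', t - 1, ?_⟩
        rw [ih, mk_addCol _ _ h']
        congr 1
        push_cast
        ring
      · refine ⟨l'.delRow, t, ?_⟩
        rw [ih, mk_delRow _ _ h]
        congr 1
        push_cast
        ring
  have hpos : (0 : ℤ) < n + m := by
    have := NeZero.pos n
    omega
  -- Modulo `n + m` the level `in + jm` is `(j - i)m`, so `i - j` steps bring it to `0`.
  obtain ⟨l', t, h⟩ := key ((i - j) % (n + m)).toNat
  rw [Int.toNat_of_nonneg (Int.emod_nonneg _ hpos.ne'), Int.emod_def] at h
  refine ⟨l', i - (i - j) / (n + m) * m + t, ?_⟩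
  rw [h]
  congr 1
  rw [hk]
  ring

/-- If the levels differed, one coordinate would force the bottom row of `l` to be longer than `m`.
At equal levels the rotations cancel and `x_injective` applies. -/
theorem hatX_normal_form_injective (hmn : Nat.Coprime m n) (l l' : Diagram n m) (q : ℤ) (d : ℕ)
    (h : hatX hmn (Cls.mk l (q * n + q * m))
      = hatX hmn (Cls.mk l' ((q + d) * n + (q + d) * m))) : l = l' ∧ d = 0 := by
  rw [hatX_mk hmn l rfl, hatX_mk hmn l' rfl] at h
  have hx : l.x = (Wt.eta n m ^ (-(d : ℤ)) * Wt.nu n m ^ (-(d : ℤ))) l'.x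
      + Wt.const (d * n + d * m) := by
    apply (Wt.eta n m ^ (-q) * Wt.nu n m ^ (-q)).injective
    apply add_right_cancel (b := Wt.const (q * n + q * m))
    rw [h, rotation_add, rotation_const, ← Equiv.Perm.mul_apply, mul_assoc,
      ← mul_assoc (Wt.nu n m ^ (-q)), ← (Wt.commute_eta_nu.zpow_zpow (-(d : ℤ)) (-q)).eq,
      mul_assoc, ← mul_assoc, ← zpow_add, ← zpow_add, ← neg_add, add_assoc, ← Wt.const_add]
    congr 2
    ring
  have hd : d = 0 := by
    by_contra hd
    -- The last `ε`-coordinate belongs to the bottom row, where `x(l)` is `n` times the largest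
    -- part.
    have hi : n - 1 < n := Nat.sub_lt (NeZero.pos n) one_pos
    have hfst := congrArg (fun Λ : Wt n m => Λ.1 ⟨n - 1, hi⟩) hx
    set i : Fin n := ⟨n - 1, hi⟩ with hidef
    set i' : Fin n := (finRotate n ^ d) i with hi'def
    have hrot : ((Wt.eta n m ^ (-(d : ℤ)) * Wt.nu n m ^ (-(d : ℤ))) l'.x).1 i = l'.x.1 i' := by
      set M := (Wt.eta n m ^ (-(d : ℤ)) * Wt.nu n m ^ (-(d : ℤ))) l'.x with hM
      have : l'.x = (Wt.nu n m ^ d) ((Wt.eta n m ^ d) M) := by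
        rw [hM, ← Equiv.Perm.mul_apply, ← Equiv.Perm.mul_apply, ← zpow_natCast, ← zpow_natCast,
          mul_assoc, ← mul_assoc (Wt.eta n m ^ (d : ℤ)), ← zpow_add, add_neg_cancel, zpow_zero,
          one_mul, ← zpow_add, add_neg_cancel, zpow_zero]
        rfl
      rw [this, Wt.nu_pow_fst, Wt.eta_pow_fst]
    simp only [Prod.fst_add, Pi.add_apply, hrot, Diagram.x_fst, Wt.const] at hfst
    have hirev : (i.rev : ℕ) = 0 := by simp only [Fin.val_rev, hidef]; omega
    have hi' : (i' : ℕ) = (n - 1 + d) % n := finRotate_pow_val d i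
    have hdiv := Nat.mod_add_div (n - 1 + d) n
    rw [← hi'] at hdiv
    have hi'rev := Fin.val_rev i'
    have hi'lt := i'.2
    set t := (n - 1 + d) / n
    have ht : 1 ≤ t := by
      rw [Nat.one_le_div_iff (NeZero.pos n)]
      omega
    have hle := l.le i.rev
    have hrev : ((i'.rev : ℕ) : ℤ) = n * t - d := by
      have : ((i' : ℕ) : ℤ) + n * t = n - 1 + d := by
        have := congrArg (fun a : ℕ => (a : ℤ)) hdiv
        push_cast [Nat.cast_sub (NeZero.pos n)] at this
        rw [this]
      omega
    rw [hirev, hrev] at hfst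
    have hn : (n : ℤ) ≠ 0 := by exact_mod_cast NeZero.ne n
    -- The terms `±dm` cancel and `n` divides out. As `t ≥ 1` and `d ≥ 1`, the right side exceeds
    -- `m`.
    have hparts : (l.parts i.rev : ℤ) = m * t + l'.parts i'.rev + d := by
      apply mul_left_cancel₀ hn
      push_cast at hfst
      linarith
    have : (m : ℤ) * 1 ≤ m * t := mul_le_mul_of_nonneg_left (by omega) (by omega)
    omega
  subst hd
  refine ⟨Diagram.x_injective ?_, rfl⟩
  have h0 : (Wt.const 0 : Wt n m) = 0 := rfl
  simpa [h0] using hx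

theorem hatX_injective (hmn : Nat.Coprime m n) : Function.Injective (hatX (n := n) hmn) := by
  intro s t h
  obtain ⟨l, q, rfl⟩ := s.exists_normal_form hmn
  obtain ⟨l', q', rfl⟩ := t.exists_normal_form hmn
  rcases le_total q q' with hq | hq
  · obtain ⟨d, rfl⟩ := Int.le.dest hq
    obtain ⟨rfl, rfl⟩ := hatX_normal_form_injective hmn l l' q d h
    simp
  · obtain ⟨d, rfl⟩ := Int.le.dest hq
    obtain ⟨rfl, rfl⟩ := hatX_normal_form_injective hmn l' l q' d h.symm
    simp

/-! ### Moves correspond to walls; the image of `x̂` is the orbit. -/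

theorem hatX_move (hmn : Nat.Coprime m n) {α : IsoRoot n m} {i j : ℤ} {l μ : Diagram n m}
    (h : Diagram.Move ((etaRoot n m ^ i * nuRoot n m ^ j) α) l μ) :
    hatX hmn (Cls.mk l (i * n + j * m)) ∈ wall α ∧
    hatX hmn (Cls.mk μ (i * n + j * m)) = hatX hmn (Cls.mk l (i * n + j * m)) + shift α := by
  obtain ⟨h1, h2⟩ := Diagram.move_spec h
  rw [hatX_mk hmn l rfl, hatX_mk hmn μ rfl, mem_wall_iff_add_const, rotation_neg_mem_wall_iff, h2,
    rotation_add, rotation_neg_shift]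
  exact ⟨h1, add_right_comm _ _ _⟩

/-- For the converse, the row added or deleted by `exists_move_of_mem_wall` changes the level by
`e·m`, which is absorbed by replacing `j` with `j + e`. -/
theorem mem_dom_iff (hmn : Nat.Coprime m n) (α : IsoRoot n m) (s : Cls n m) :
    s ∈ Cls.dom α ↔ hatX hmn s ∈ wall α := by
  constructor
  · rintro ⟨i, j, l, μ, h, rfl⟩
    exact (hatX_move hmn h).1
  · intro h
    obtain ⟨l, k, rfl⟩ := s.exists_mk_eq
    obtain ⟨i, j, rfl⟩ := exists_eq_mul_add_mul hmn k
    rw [hatX_mk hmn l rfl, mem_wall_iff_add_const, rotation_neg_mem_wall_iff] at h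
    obtain ⟨e, l', μ, h1, h2⟩ := l.exists_move_of_mem_wall hmn _ h
    refine ⟨i, j + e, l', μ, ?_, ?_⟩
    · rw [← Equiv.Perm.mul_apply, ← mul_assoc,
        ← (commute_etaRoot_nuRoot.zpow_zpow i e).eq, mul_assoc, ← zpow_add, add_comm e] at h2
      exact h2
    · rw [h1]
      congr 1
      ring

/-- The moves of diagrams connect the values of `x̂` in the Cayley graph. -/
theorem eqvGen_hatX_of_move (hmn : Nat.Coprime m n) {β : IsoRoot n m} {l μ : Diagram n m}
    (h : Diagram.Move β l μ) (k : ℤ) :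
    Relation.EqvGen (cayleyGraph (SV n m)).Adj (hatX hmn (Cls.mk l k))
      (hatX hmn (Cls.mk μ k)) := by
  obtain ⟨i, j, rfl⟩ := exists_eq_mul_add_mul hmn k
  obtain ⟨α, rfl⟩ := (etaRoot n m ^ i * nuRoot n m ^ j).surjective β
  obtain ⟨h1, h2⟩ := hatX_move hmn h
  exact .rel _ _ ((cayleyGraph_SV_adj_iff _ _).2 ⟨α, h1, .inr h2⟩)

/-- The end of the last nonempty row is an inner corner. The number of boxes is the measure for the
induction down to the empty diagram. -/
theorem Diagram.exists_removable_box {n m : ℕ} (l : Diagram n m) (hl : l ≠ Diagram.empty n m) :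
    ∃ (β : IsoRoot n m) (μ : Diagram n m), Move β l μ ∧ ∑ p, μ.parts p < ∑ p, l.parts p := by
  have hne : (Finset.univ.filter fun p => 0 < l.parts p).Nonempty := by
    by_contra hne
    rw [Finset.not_nonempty_iff_eq_empty, Finset.filter_eq_empty_iff] at hne
    exact hl (Diagram.ext (funext fun p => Nat.eq_zero_of_not_pos (hne (Finset.mem_univ p))))
  set p := (Finset.univ.filter fun p => 0 < l.parts p).max' hne with hp
  have hp0 : 0 < l.parts p := (Finset.mem_filter.1 (Finset.max'_mem _ hne)).2
  have hpm := l.le p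
  obtain ⟨μ, hμ⟩ := l.exists_move_remove p ⟨l.parts p - 1, by omega⟩
    (by simp only; omega) fun q hq => by
      have : ¬ 0 < l.parts q := fun h0 =>
        (Finset.le_max' _ q (Finset.mem_filter.2 ⟨Finset.mem_univ q, h0⟩)).not_gt hq
      omega
  refine ⟨_, μ, hμ, ?_⟩
  obtain ⟨h1, h2⟩ := parts_eq_of_move ((move_false_iff _ _ _ _).1 hμ)
  refine Finset.sum_lt_sum (fun q _ => ?_) ⟨p, Finset.mem_univ p, ?_⟩
  · rw [h2]
    by_cases hq : q = p.rev.rev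
    · subst hq; rw [Function.update_self, h1]; omega
    · rw [Function.update_of_ne hq]
  · rw [Fin.rev_rev] at h1
    rw [h1]
    simp only
    omega

theorem eqvGen_hatX_empty (hmn : Nat.Coprime m n) (l : Diagram n m) (k : ℤ) :
    Relation.EqvGen (cayleyGraph (SV n m)).Adj (hatX hmn (Cls.mk l k))
      (hatX hmn (Cls.mk (Diagram.empty n m) k)) := by
  induction hs : ∑ p, l.parts p using Nat.strong_induction_on generalizing l with
  | _ s ih =>
    by_cases hl : l = Diagram.empty n m
    · subst hl; exact .refl _
    · obtain ⟨β, μ, h1, h2⟩ := l.exists_removable_box hl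
      exact (eqvGen_hatX_of_move hmn h1 k).trans _ _ _ (ih _ (hs ▸ h2) μ rfl)

/-- Different levels are linked through full rows and columns: a single full row at level `k` is the
class `[∅, k + m]`, and removing its boxes leads to `[∅, k]`. Likewise a full column links `k` to `k
+ n`, and coprimality reaches every level from `0`. -/
theorem hatX_mem_actionOrbit (hmn : Nat.Coprime m n) (s : Cls n m) :
    hatX hmn s ∈ actionOrbit (SV n m) (Wt.base n m) := by
  let R : ℤ → ℤ → Prop := fun k k' => Relation.EqvGen (cayleyGraph (SV n m)).Adj
    (hatX hmn (Cls.mk (Diagram.empty n m) k)) (hatX hmn (Cls.mk (Diagram.empty n m) k'))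
  have hrow : ∀ k, R k (k + m) := fun k => by
    have h := eqvGen_hatX_empty hmn (Diagram.empty n m).addRow k
    rw [Cls.mk_delRow _ _ (Diagram.parts_zero_addRow _),
      Diagram.delRow_addRow _ fun _ _ => rfl] at h
    exact h.symm _ _
  have hcol : ∀ k, R k (k + n) := fun k => by
    have hz : ∀ p, (Diagram.empty n m).parts p < m := fun _ => NeZero.pos m
    have h := eqvGen_hatX_empty hmn ((Diagram.empty n m).addCol hz) k
    rw [Cls.mk_delCol _ _ (Diagram.conj_zero_addCol _ hz), Diagram.delCol_addCol] at h
    exact h.symm _ _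
  have hmul : ∀ c : ℤ, (∀ k, R k (k + c)) → ∀ (t : ℤ) k, R k (k + t * c) := by
    intro c hc t
    induction t using Int.induction_on with
    | zero => intro k; rw [zero_mul, add_zero]; exact .refl _
    | succ t ih =>
      intro k
      have h := (ih k).trans _ _ _ (hc _)
      rwa [add_assoc, ← add_one_mul] at h
    | pred t ih =>
      intro k
      have h := hc (k + (-t - 1) * c)
      rw [show k + (-(t : ℤ) - 1) * c + c = k + -t * c by ring] at h
      exact (ih k).trans _ _ _ (h.symm _ _)
  obtain ⟨l, k, rfl⟩ := s.exists_mk_eq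
  obtain ⟨i, j, rfl⟩ := exists_eq_mul_add_mul hmn k
  have h1 := (hmul n hcol i 0).trans _ _ _ (hmul m hrow j _)
  rw [zero_add] at h1
  have h2 := h1.trans _ _ _ ((eqvGen_hatX_empty hmn l _).symm _ _)
  rw [hatX_empty hmn] at h2
  exact h2

/-- If `x̂(s)` is on a wall, `mem_dom_iff` supplies a diagram move at `s` realizing the shift, so
the image is closed under the action. -/
theorem exists_hatX_eq (hmn : Nat.Coprime m n) {Λ : Wt n m}
    (h : Λ ∈ actionOrbit (SV n m) (Wt.base n m)) : ∃ s, hatX hmn s = Λ := by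
  refine mem_of_mem_actionOrbit_SV (S := Set.range (hatX hmn)) ?_ ⟨_, hatX_empty hmn⟩ h
  rintro α _ hα ⟨s, rfl⟩
  obtain ⟨i, j, l, μ, hμ, rfl⟩ := (mem_dom_iff hmn α s).2 hα
  exact ⟨_, (hatX_move hmn hμ).2⟩

/-! ### The action on classes, its uniqueness, and the theorem. -/

/-- The bijection from the set of classes onto the orbit of `Λ₀` given by `x̂`. -/
noncomputable def hatXEquiv (hmn : Nat.Coprime m n) :
    Cls n m ≃ actionOrbit (SV n m) (Wt.base n m) :=
  Equiv.ofBijective (fun s => ⟨hatX hmn s, hatX_mem_actionOrbit hmn s⟩)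
    ⟨fun _ _ h => hatX_injective hmn (congrArg Subtype.val h), fun Λ =>
      (exists_hatX_eq hmn Λ.2).imp fun _ h => Subtype.ext h⟩

/-- The action of `𝔗_iso` on the set of classes. -/
noncomputable def diagramAction (hmn : Nat.Coprime m n) : IsoRoot n m ⥤ SymGpd (Cls n m) :=
  transportAction (hatXEquiv hmn) (restrictToOrbit (SV n m) (Wt.base n m))

theorem isDiagramAction_diagramAction (hmn : Nat.Coprime m n) :
    IsDiagramAction (diagramAction (n := n) hmn) where
  obj_eq α := Set.ext fun s => (mem_dom_iff hmn α s).symm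
  map_rho α i j l μ hμ h := hatX_injective hmn <| by
    have h1 := congrArg Subtype.val (transportAction_map (hatXEquiv hmn)
      (restrictToOrbit (SV n m) (Wt.base n m)) (rho α) ⟨_, h⟩)
    exact h1.trans ((SV_map_rho α ⟨_, h⟩).trans (hatX_move hmn hμ).2.symm)

/-- The only morphisms are identities and the `ρ_α`, and each class in the domain of `ρ_α` has a
representative at which the move is defined. -/
theorem IsDiagramAction.unique {F F' : IsoRoot n m ⥤ SymGpd (Cls n m)} (h : IsDiagramAction F)
    (h' : IsDiagramAction F') : F = F' := by
  refine functor_symGpd_ext (fun α => (h.obj_eq α).trans (h'.obj_eq α).symm) ?_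
  intro α β s x hx hx'
  induction s using isoRoot_hom_cases with
  | hid => rw [F.map_id, F'.map_id]; rfl
  | hrho =>
    have hdom := hx
    rw [h.obj_eq] at hdom
    obtain ⟨i, j, l, μ, hμ, rfl⟩ := hdom
    rw [h.map_rho α i j l μ hμ, h'.map_rho α i j l μ hμ]

end HatX

theorem theorem1p1 (n m : ℕ) [NeZero n] [NeZero m] (hmn : Nat.Coprime m n) :
    ∃ (𝔽 : IsoRoot n m ⥤ SymGpd (Cls n m)) (xhat : Cls n m → Wt n m),
      (IsDiagramAction 𝔽 ∧ ∀ 𝔽', IsDiagramAction 𝔽' → 𝔽' = 𝔽) ∧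
      (IsHatX xhat ∧ ∀ f, IsHatX f → f = xhat) ∧
      xhat (Cls.mk (Diagram.empty n m) 0) = Wt.base n m ∧
      ∃ hO : ∀ s, xhat s ∈ actionOrbit (SV n m) (Wt.base n m),
        IsEquivariantBijection 𝔽 (restrictToOrbit (SV n m) (Wt.base n m))
          (fun s => ⟨xhat s, hO s⟩) ∧
        ∃ φ : (cayleyGraph 𝔽).Adj ≃r
            (cayleyGraph (restrictToOrbit (SV n m) (Wt.base n m))).Adj,
          ∀ s, (φ s : Wt n m) = xhat s := by
  refine ⟨diagramAction hmn, hatX hmn,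
    ⟨isDiagramAction_diagramAction hmn, fun _ h => h.unique (isDiagramAction_diagramAction hmn)⟩,
    ⟨isHatX_hatX hmn, fun _ h => h.unique hmn (isHatX_hatX hmn)⟩, hatX_empty hmn,
    hatX_mem_actionOrbit hmn, ?_, ⟨hatXEquiv hmn, ?_⟩, fun _ => rfl⟩
  · exact isEquivariantBijection_transportAction (hatXEquiv hmn) _
      (isTransitiveAction_restrictToOrbit _ _)
  · exact cayleyGraph_transportAction (hatXEquiv hmn) _ _ _
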